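/- A NAND-AND-OR-NOT DAG is a directed acyclic graph $G=(V,E)$ with $V=\{v_1,\dots,v_n\}$, topologically sorted ($(v_i,v_j)\in E$ implies $i<j$), in which no vertex has out-degree $1$. Let $L$ be the set of its sinks, $\hat n=n-|L|$ and $m=|E|$; the sinks are the vertices $v_i$ with $i>\hat n$. Each sink is labelled with a Boolean variable, each vertex $v_i$ of out-degree $d_i\ge 2$ with a function $h_i\in\{\mathrm{NAND},\mathrm{AND},\mathrm{OR}\}$, and each edge $(v_i,v_j)$ with $\sigma(i,j)\in\{0,1\}$. It is a NAND-NOT DAG if every $h_i$ is NAND. Given values of the variables, the value $r_i$ of a sink is that of its variable, and otherwise $r_i=h_i\bigl(r_{j_1}^{\sigma(i,j_1)},\dots,r_{j_w}^{\sigma(i,j_w)}\bigr)$, where $D_i=(v_{j_1},\dots,v_{j_w})$ is the array of the out-neighbours of $v_i$, $b^1=b$ and $b^0=\neg b$. Evaluating $G$ with root $v_s$ means computing $r_s$. The algorithms access $G$ in the adjacency list model: a black box answers queries for the out-neighbours in the arrays $D_i$, the degrees and labels, the values of the variables and the stored results; quantum queries may be in superposition. The running time is the number of accesses to the black box. Call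 a family $\hat Q_h^k$ (for $h\in\{\mathrm{NAND},\mathrm{AND},\mathrm{OR}\}$ and integers $k\ge1$) of quantum query algorithms boosted if on $d\ge1$ argument bits $\hat Q_h^k$ makes $O(\sqrt{kd})$ queries and computes $h$ with error probability $O(2^{-k})$, with constants independent of $k$ and $d$. The evaluation algorithm with such subroutines computes, for $i=\hat n,\hat n-1,\dots,s$, $$t[i]\gets \hat Q_{h_i}^{k}\bigl(t_f(j_1)^{\sigma(i,j_1)},\dots,t_f(j_w)^{\sigma(i,j_w)}\bigr),\qquad k=\lceil 2\log_2\hat n\rceil,$$ where $t_f(j)=t[j]$ for $j\le\hat n$ and $t_f(j)$ is the value of the variable of $v_j$ for $j>\hat n$, and returns $t_f(s)$. Theorem 2. Boosted families exist, and with any boosted family the evaluation algorithm evaluates all NAND-AND-OR-NOT DAGs, and all NAND-NOT DAGs, with $\hat n\ge 2$, for every root and all values of the variables, in running time $O(\sqrt{\hat n m\log\hat n})$, hence $O(\sqrt{nm\log n})$, and with error probability $O(1/\hat n)$. The implied constants depend only on the boosted family. -/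

import Mathlib

/-! ## Quantum query algorithms -/

/-- The interface of a black box: finitely or infinitely many ports; a query to port `p` at an
address in `Addr p` is answered by a word in the group `Ans p`. -/
structure OracleType where
  Port : Type
  Addr : Port → Type
  Ans : Port → Type
  grp : ∀ p, AddCommGroup (Ans p)

attribute [instance] OracleType.grp

/-- The contents of a black box. -/
def OracleType.Contents (O : OracleType) : Type := ∀ p, O.Addr p → O.Ans p

/-- One step of a quantum query algorithm whose computational basis is `S`: either a unitary that
does not depend on the black box, or one query.  For a query, the basis is split by `e` into an
answer register `O.Ans p` and the rest `R`, and the step is the unitary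
`|r, b⟩ ↦ |r, b + X (addr r)⟩`, where `X` is the content of the port `p`. -/
inductive QStep (O : OracleType) (S : Type) [Fintype S] [DecidableEq S] : Type 1
  | gate (U : Matrix.unitaryGroup S ℂ) : QStep O S
  | query (p : O.Port) (R : Type) (e : S ≃ R × O.Ans p) (addr : R → O.Addr p) : QStep O S

section QStep

variable {O : OracleType} {S : Type} [Fintype S] [DecidableEq S]

/-- The action of a step on a vector of amplitudes. -/
noncomputable def QStep.act (X : O.Contents) : QStep O S → (S → ℂ) → (S → ℂ)
  | .gate U, ψ => (U : Matrix S S ℂ).mulVec ψ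
  | .query p _ e addr, ψ => fun s => ψ (e.symm ((e s).1, (e s).2 - X p (addr (e s).1)))

/-- A step costs one if it is a query, and nothing otherwise. -/
def QStep.cost : QStep O S → ℕ
  | .gate _ => 0
  | .query _ _ _ _ => 1

theorem QStep.sum_normSq_act (X : O.Contents) (q : QStep O S) (ψ : S → ℂ) :
    ∑ s, ‖q.act X ψ s‖ ^ 2 = ∑ s, ‖ψ s‖ ^ 2 := by
  cases q with
  | gate U =>
    have key : ∀ φ : S → ℂ, ((∑ s, ‖φ s‖ ^ 2 : ℝ) : ℂ) = dotProduct (star φ) φ := by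
      intro φ
      push_cast
      refine Finset.sum_congr rfl fun s _ => ?_
      simp [Complex.conj_mul']
    have h : (star (U : Matrix S S ℂ)) * (U : Matrix S S ℂ) = 1 :=
      (Matrix.mem_unitaryGroup_iff').1 U.2
    have : ((∑ s, ‖(U : Matrix S S ℂ).mulVec ψ s‖ ^ 2 : ℝ) : ℂ)
        = ((∑ s, ‖ψ s‖ ^ 2 : ℝ) : ℂ) := by
      rw [key, key, Matrix.star_mulVec, Matrix.dotProduct_mulVec, Matrix.vecMul_vecMul,
        ← Matrix.star_eq_conjTranspose, h, Matrix.vecMul_one]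
    exact_mod_cast this
  | query p R e addr =>
    let f : S ≃ S :=
      { toFun := fun s => e.symm ((e s).1, (e s).2 - X p (addr (e s).1))
        invFun := fun s => e.symm ((e s).1, (e s).2 + X p (addr (e s).1))
        left_inv := fun s => by simp
        right_inv := fun s => by simp }
    exact Equiv.sum_comp f (fun s => ‖ψ s‖ ^ 2)

end QStep

/-- A quantum query algorithm for black boxes of type `O` with outputs in `β`: it starts in the
basis state `init`, performs the list of steps, measures the whole register at the end, and
outputs `out s` for the outcome `s`. -/
structure QAlg (O : OracleType) (β : Type) : Type 1 where
  S : Type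
  fin : Fintype S
  dec : DecidableEq S
  init : S
  steps : List (QStep O S)
  out : S → β

attribute [instance] QAlg.fin QAlg.dec

namespace QAlg

variable {O : OracleType} {β : Type}

/-- The state before the final measurement. -/
noncomputable def final (Q : QAlg O β) (X : O.Contents) : Q.S → ℂ :=
  Q.steps.foldl (fun ψ q => q.act X ψ) (Pi.single Q.init 1)

/-- The number of queries. -/
def cost (Q : QAlg O β) : ℕ := (Q.steps.map QStep.cost).sum

theorem sum_normSq_final (Q : QAlg O β) (X : O.Contents) : ∑ s, ‖Q.final X s‖ ^ 2 = 1 := by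
  have h : ∀ (l : List (QStep O Q.S)) (ψ : Q.S → ℂ),
      ∑ s, ‖l.foldl (fun ψ q => q.act X ψ) ψ s‖ ^ 2 = ∑ s, ‖ψ s‖ ^ 2 := by
    intro l
    induction l with
    | nil => intro ψ; rfl
    | cons q l ih => intro ψ; rw [List.foldl_cons, ih, QStep.sum_normSq_act]
  rw [final, h, Finset.sum_eq_single Q.init]
  · simp
  · intro s _ hs; simp [hs]
  · simp

/-- The distribution of the outcome of the final measurement (Born rule). -/
noncomputable def measured (Q : QAlg O β) (X : O.Contents) : PMF Q.S :=
  PMF.ofFintype (fun s => ENNReal.ofReal (‖Q.final X s‖ ^ 2)) (by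
    rw [← ENNReal.ofReal_sum_of_nonneg (fun s _ => by positivity), sum_normSq_final,
      ENNReal.ofReal_one])

/-- The distribution of the output. -/
noncomputable def dist (Q : QAlg O β) (X : O.Contents) : PMF β := (Q.measured X).map Q.out

end QAlg

/-! ## Gates and the quantum subroutines that compute them -/

/-- The functions that may label a function-vertex. -/
inductive GateLabel
  | nand
  | and
  | or

/-- The Boolean function of arity `d` that belongs to a label. -/
def GateLabel.eval {d : ℕ} : GateLabel → (Fin d → Bool) → Bool
  | .nand, x => !decide (∀ z, x z = true)
  | .and, x => decide (∀ z, x z = true)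
  | .or, x => decide (∃ z, x z = true)

/-- A Boolean as an element of `ℤ/2`. -/
def bit (b : Bool) : ZMod 2 := if b then 1 else 0

/-- Black boxes that hold a string of `d` bits. -/
def BitOracle (d : ℕ) : OracleType where
  Port := Unit
  Addr _ := Fin d
  Ans _ := ZMod 2
  grp _ := inferInstanceAs (AddCommGroup (ZMod 2))

/-- The black box that holds the string `x`. -/
def bitContents {d : ℕ} (x : Fin d → Bool) : (BitOracle d).Contents := fun _ z => bit (x z)

/-- A family of quantum query algorithms `Q h k d` on strings of `d` bits, one for every gate `h`,
boosting parameter `k` and arity `d`, is boosted if `Q h k d` makes `O(√(k d))` queries and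
computes `h` with error probability `O(1 / 2 ^ k)`. -/
def IsBoosted (Q : GateLabel → ℕ → (d : ℕ) → QAlg (BitOracle d) Bool) : Prop :=
  ∃ c : ℝ, ∀ (h : GateLabel) (k d : ℕ), 1 ≤ k → 1 ≤ d →
    ((Q h k d).cost : ℝ) ≤ c * √((k : ℝ) * d) ∧
    ∀ x : Fin d → Bool,
      ((Q h k d).dist (bitContents x)).toOuterMeasure {b | b ≠ h.eval x} ≤
        ENNReal.ofReal (c / 2 ^ k)

/-! ## Circuits with shared inputs -/

/-- A NAND-AND-OR-NOT DAG on the vertices `0, …, n - 1` with variables in `ι`, given by the arrays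
`D i` of out-neighbours. -/
structure CircuitDag (n : ℕ) (ι : Type) where
  /-- out-degree -/
  deg : Fin n → ℕ
  /-- the array of the out-neighbours of a vertex, -/
  D : (i : Fin n) → Fin (deg i) → Fin n
  /-- without repetitions -/
  D_injective : ∀ i, Function.Injective (D i)
  /-- topologically sorted (in particular acyclic) -/
  sorted : ∀ i z, i < D i z
  /-- the sinks are the last vertices: all vertices from `n - |L|` on are sinks -/
  sinks_last : ∀ i : Fin n,
    n - (Finset.univ.filter fun j => deg j = 0).card ≤ (i : ℕ) → deg i = 0
  /-- no vertex has out-degree one -/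
  deg_ne_one : ∀ i, deg i ≠ 1
  /-- the label of a function-vertex (irrelevant at sinks) -/
  gate : Fin n → GateLabel
  /-- the variable of a variable-vertex (irrelevant at the other vertices) -/
  var : Fin n → ι
  /-- the label `σ(i,j)` of the edge from `i` to `j` (irrelevant at non-edges);
  `true` stands for `1` and `false` for `0` -/
  σ : Fin n → Fin n → Bool

/-- `x^1 = x` and `x^0 = ¬x`. -/
def literal (b : Bool) (e : Bool) : Bool := if e then b else !b

namespace CircuitDag

variable {n : ℕ} {ι : Type}

/-- The set `L` of sinks. -/
def sinks (G : CircuitDag n ι) : Finset (Fin n) := Finset.univ.filter fun j => G.deg j = 0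

/-- The number of vertices that are not sinks. -/
def nhat (G : CircuitDag n ι) : ℕ := n - G.sinks.card

/-- The set of edges. -/
def edges (G : CircuitDag n ι) : Finset (Fin n × Fin n) :=
  Finset.univ.filter fun e => ∃ z, G.D e.1 z = e.2

/-- The number of edges. -/
def m (G : CircuitDag n ι) : ℕ := G.edges.card

/-- A NAND-NOT DAG: all function-vertices are labelled with NAND. -/
def IsNandNot (G : CircuitDag n ι) : Prop := ∀ i, G.deg i ≠ 0 → G.gate i = GateLabel.nand

/-- The value `r i` of a vertex under an assignment `x` of the variables. -/
def value (G : CircuitDag n ι) (x : ι → Bool) (i : Fin n) : Bool :=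
  if G.deg i = 0 then x (G.var i)
  else (G.gate i).eval fun z => literal (G.value x (G.D i z)) (G.σ i (G.D i z))
termination_by n - i
decreasing_by
  have := G.sorted i z
  omega

end CircuitDag

/-! ## The black box of the algorithm and programs that use it -/

/-- The contents of the memory that the algorithm accesses: the graph in the adjacency list model,
with its labels, and the stored bits `val j`. -/
structure Box (n : ℕ) where
  deg : Fin n → ℕ
  gate : Fin n → GateLabel
  nbr : Fin n → ℕ → Fin n
  label : Fin n → ℕ → Bool
  val : Fin n → Bool

/-- The three ports for queries in superposition. -/
inductive BoxPort
  | nbr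
  | label
  | val

/-- Queries in superposition: the `z`-th out-neighbour of a vertex, the label of its `z`-th
outgoing edge, the bit stored for a vertex. -/
def BoxOracle (n : ℕ) [NeZero n] : OracleType where
  Port := BoxPort
  Addr
    | .nbr => Fin n × ℕ
    | .label => Fin n × ℕ
    | .val => Fin n
  Ans
    | .nbr => Fin n
    | .label => ZMod 2
    | .val => ZMod 2
  grp
    | .nbr => inferInstanceAs (AddCommGroup (Fin n))
    | .label => inferInstanceAs (AddCommGroup (ZMod 2))
    | .val => inferInstanceAs (AddCommGroup (ZMod 2))

namespace Box

variable {n : ℕ}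

/-- The black box seen by quantum queries. -/
def contents [NeZero n] (M : Box n) : (BoxOracle n).Contents
  | .nbr => fun a => M.nbr a.1 a.2
  | .label => fun a => bit (M.label a.1 a.2)
  | .val => fun j => bit (M.val j)

/-- Overwriting the stored bit of a vertex. -/
def store (M : Box n) (j : Fin n) (b : Bool) : Box n :=
  { M with val := Function.update M.val j b }

end Box

/-- The initial memory for a DAG `G` and an assignment `x`: sinks hold the value of their variable,
and the array of results for the other vertices is filled with `false`.  Array accesses out of
range give a fixed junk answer. -/
def CircuitDag.box {n : ℕ} {ι : Type} (G : CircuitDag n ι) (x : ι → Bool) : Box n where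
  deg := G.deg
  gate := G.gate
  nbr i z := if h : z < G.deg i then G.D i ⟨z, h⟩ else i
  label i z := if h : z < G.deg i then G.σ i (G.D i ⟨z, h⟩) else false
  val j := if G.deg j = 0 then x (G.var j) else false

/-- Programs with classical control. Apart from their parameters they depend on the black box only
through the answers they receive. -/
inductive Prog (n : ℕ) [NeZero n] (α : Type) : Type 1
  | ret (a : α) : Prog n α
  | readDeg (i : Fin n) (next : ℕ → Prog n α) : Prog n α
  | readGate (i : Fin n) (next : GateLabel → Prog n α) : Prog n α
  | readVal (i : Fin n) (next : Bool → Prog n α) : Prog n α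
  | write (i : Fin n) (b : Bool) (next : Prog n α) : Prog n α
  | quantum (Q : QAlg (BoxOracle n) Bool) (next : Bool → Prog n α) : Prog n α

/-- The joint distribution of the output of a program and of its running time: every classical
access to the black box costs one, and a quantum subroutine costs the number of its queries. -/
noncomputable def Prog.run {n : ℕ} [NeZero n] {α : Type} : Prog n α → Box n → PMF (α × ℕ)
  | .ret a, _ => PMF.pure (a, 0)
  | .readDeg i next, M => ((next (M.deg i)).run M).map fun p => (p.1, p.2 + 1)
  | .readGate i next, M => ((next (M.gate i)).run M).map fun p => (p.1, p.2 + 1)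
  | .readVal i next, M => ((next (M.val i)).run M).map fun p => (p.1, p.2 + 1)
  | .write i b next, M => (next.run (M.store i b)).map fun p => (p.1, p.2 + 1)
  | .quantum Q next, M =>
      (Q.dist M.contents).bind fun b => ((next b).run M).map fun p => (p.1, p.2 + Q.cost)

/-! ## The evaluation algorithm -/

/-- A permutation of the basis as a unitary gate, `|s⟩ ↦ |f s⟩`. -/
def permGate {S : Type} [Fintype S] [DecidableEq S] (f : Equiv.Perm S) :
    Matrix.unitaryGroup S ℂ :=
  ⟨Matrix.of fun s s' => if s = f s' then 1 else 0, by
    rw [Matrix.mem_unitaryGroup_iff']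
    ext a b
    simp [Matrix.mul_apply, Matrix.star_apply, Matrix.one_apply, eq_comm]⟩

/-- The gate `U` applied to the first factor. -/
def liftGate {S W : Type} [Fintype S] [DecidableEq S] [Fintype W] [DecidableEq W]
    (U : Matrix.unitaryGroup S ℂ) : Matrix.unitaryGroup (S × W) ℂ :=
  ⟨Matrix.kroneckerMap (· * ·) (U : Matrix S S ℂ) (1 : Matrix W W ℂ),
    Matrix.kronecker_mem_unitary U.2 (one_mem _)⟩

/-- One step of an algorithm for `d` bits, carried out on the `d` arguments of the vertex `i`.  An
additional register for a vertex is used.  A query for the `z`-th bit looks up the `z`-th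
out-neighbour `j` of `i`, adds the label of the edge, `1`, and the bit stored for `j` to the answer
register (in total `b ^ σ` for the stored bit `b` and the label `σ`), and clears the additional
register by looking up `j` again. -/
def liftStep {n : ℕ} [NeZero n] (i : Fin n) {d : ℕ} {S : Type} [Fintype S] [DecidableEq S] :
    QStep (BitOracle d) S → List (QStep (BoxOracle n) (S × Fin n))
  | .gate U => [.gate (liftGate U)]
  | .query _ R e addr =>
      let addr' : R → Fin d := addr
      let e' : S ≃ R × ZMod 2 := e
      let word : S × Fin n ≃ (R × ZMod 2) × Fin n := e'.prodCongr (Equiv.refl _)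
      let bitReg : S × Fin n ≃ (R × Fin n) × ZMod 2 :=
        word.trans
          { toFun := fun p => ((p.1.1, p.2), p.1.2)
            invFun := fun p => ((p.1.1, p.2), p.1.2)
            left_inv := fun _ => rfl
            right_inv := fun _ => rfl }
      [ .query BoxPort.nbr (R × ZMod 2) word (fun r => (i, (addr' r.1 : ℕ))),
        .query BoxPort.label (R × Fin n) bitReg (fun r => (i, (addr' r.1 : ℕ))),
        .gate (permGate ((bitReg.trans
          ((Equiv.refl (R × Fin n)).prodCongr (Equiv.addRight (1 : ZMod 2)))).trans bitReg.symm)),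
        .query BoxPort.val (R × Fin n) bitReg (fun r => r.2),
        .gate (permGate ((Equiv.refl S).prodCongr (Equiv.neg (Fin n)))),
        .query BoxPort.nbr (R × ZMod 2) word (fun r => (i, (addr' r.1 : ℕ))) ]

/-- A quantum algorithm for `d` bits, carried out on the arguments
`t(j₁)^σ(i,j₁), …, t(j_d)^σ(i,j_d)` of the vertex `i`, where `t` are the stored bits. -/
def liftAlg {n : ℕ} [NeZero n] (i : Fin n) {d : ℕ} (Q : QAlg (BitOracle d) Bool) :
    QAlg (BoxOracle n) Bool where
  S := Q.S × Fin n
  fin := inferInstance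
  dec := inferInstance
  init := (Q.init, 0)
  steps := Q.steps.flatMap (liftStep i)
  out s := Q.out s.1

/-- The loop over a list of vertices, followed by the output of the value of `s`. -/
def evalLoop {n : ℕ} [NeZero n] (Q : GateLabel → ℕ → (d : ℕ) → QAlg (BitOracle d) Bool)
    (k : ℕ) (s : Fin n) : List (Fin n) → Prog n Bool
  | [] => .readVal s fun b => .ret b
  | i :: l =>
      .readDeg i fun d =>
      .readGate i fun h =>
      .quantum (liftAlg i (Q h k d)) fun b =>
      .write i b (evalLoop Q k s l)

/-- The evaluation algorithm with the subroutines `Q`: the non-sink vertices are processed from the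
last one down to the root `s`, with boosting parameter `2 log₂ n̂` (rounded up). -/
noncomputable def evalAlg {n : ℕ} [NeZero n]
    (Q : GateLabel → ℕ → (d : ℕ) → QAlg (BitOracle d) Bool) (nhat : ℕ) (s : Fin n) :
    Prog n Bool :=
  evalLoop Q ⌈2 * Real.logb 2 nhat⌉₊ s
    ((List.finRange n).reverse.filter fun i => decide (s ≤ i ∧ (i : ℕ) < nhat))

/-- The algorithm with the subroutines `Q` evaluates `G`, for every root `s` and every assignment
`x`, in running time at most `C √(n̂ m log n̂)` and at most `C √(n m log n)`, with error probability
at most `C / n̂`. -/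
def EvaluatesWithin (Q : GateLabel → ℕ → (d : ℕ) → QAlg (BitOracle d) Bool) (C : ℝ)
    {n : ℕ} [NeZero n] {ι : Type} (G : CircuitDag n ι) : Prop :=
  ∀ (x : ι → Bool) (s : Fin n),
    (∀ p ∈ ((evalAlg Q G.nhat s).run (G.box x)).support,
      (p.2 : ℝ) ≤ C * √((G.nhat : ℝ) * G.m * Real.log G.nhat) ∧
      (p.2 : ℝ) ≤ C * √((n : ℝ) * G.m * Real.log n)) ∧
    ((evalAlg Q G.nhat s).run (G.box x)).toOuterMeasure {p | p.1 ≠ G.value x s} ≤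
      ENNReal.ofReal (C / G.nhat)

/-! Boosted subroutines. All gates reduce to the search for an argument with a given value
`target`. Amplitude amplification with `j` rounds costs `2 j + 1` queries and, if the targets have
initial weight `sin² θ`, misses them with probability at most `cos² ((2 j + 1) θ)`
(`missProb_amplify_le`). It never reports a target that does not exist, so several runs can be
combined by a disjunction, and their miss probabilities multiply (`QAlg.missProb_any`). For every
`t ≤ k` one run is tuned to succeed with certainty if there are exactly `t` targets; these runs cost
`∑ O(√(d / t)) = O(√(k d))` in total. If there are more than `k` targets, some `l` with
`3 ^ l ≤ 3 √(d / k)` brings `3 ^ l θ` to within `π / 4` of a right angle, so `k` runs with `3 ^ l`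
queries for each such `l` miss all targets with probability at most `2⁻ᵏ`; by the geometric series
they cost `O(k √(d / k)) = O(√(k d))`.

The evaluation algorithm. Each lifted step computes one argument bit of a gate and clears the
auxiliary register again, so that the lifted subroutine has the output distribution of the original
one on the string of arguments (`dist_liftAlg`), at four times the cost. In the order of evaluation
all out-neighbours of a vertex come before it, hence a union bound over the `n̂` gates bounds the
error by `n̂ · O(2⁻ᵏ) = O(1 / n̂)` (`error_evalLoop`). The running time is
`O(n̂ + ∑ √(k dᵢ)) = O(√(k n̂ m))` by the Cauchy–Schwarz inequality
(`CircuitDag.sum_sqrt_deg_le`); here `n̂ ≤ m` absorbs the classical accesses. -/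

/-! ### Unitary gates and algorithms on product registers -/

theorem liftGate_mulVec {S W : Type} [Fintype S] [DecidableEq S] [Fintype W] [DecidableEq W]
    (U : Matrix.unitaryGroup S ℂ) (ψ : S × W → ℂ) (s : S) (w : W) :
    (liftGate (W := W) U : Matrix (S × W) (S × W) ℂ).mulVec ψ (s, w) =
      (U : Matrix S S ℂ).mulVec (fun s' => ψ (s', w)) s := by
  simp [liftGate, Matrix.mulVec, dotProduct, Fintype.sum_prod_type, Matrix.one_apply]

theorem permGate_mulVec {S : Type} [Fintype S] [DecidableEq S] (f : Equiv.Perm S) (ψ : S → ℂ)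
    (s : S) : (permGate f : Matrix S S ℂ).mulVec ψ s = ψ (f.symm s) := by
  simp only [permGate, Matrix.mulVec, dotProduct, Matrix.of_apply, ite_mul, one_mul, zero_mul]
  rw [Finset.sum_eq_single (f.symm s)]
  · simp
  · intro b _ hb
    rw [if_neg]
    rintro rfl
    simp at hb
  · simp

namespace QStep

variable {O : OracleType} {S W T : Type} [Fintype S] [DecidableEq S] [Fintype W] [DecidableEq W]
  [Fintype T] [DecidableEq T]

theorem act_smul (X : O.Contents) (q : QStep O S) (a : ℂ) (ψ : S → ℂ) :
    q.act X (fun s => ψ s * a) = fun s => q.act X ψ s * a := by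
  cases q with
  | gate U =>
    funext s
    simp only [act, Matrix.mulVec, dotProduct, Finset.sum_mul, mul_assoc]
  | query p R e addr => rfl

/-- The step `q` carried out on the first factor of a register identified with `S × W` by `f`. -/
def extend (f : T ≃ S × W) : QStep O S → QStep O T
  | .gate U => .gate ⟨Matrix.submatrix (liftGate (W := W) U : Matrix (S × W) (S × W) ℂ) f f, by
      rw [Matrix.mem_unitaryGroup_iff, Matrix.star_eq_conjTranspose, Matrix.conjTranspose_submatrix,
        Matrix.submatrix_mul_equiv, ← Matrix.star_eq_conjTranspose,
        Matrix.mem_unitaryGroup_iff.1 (liftGate (W := W) U).2, Matrix.submatrix_one_equiv]⟩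
  | .query p R e addr => .query p (R × W)
      ((f.trans (e.prodCongr (Equiv.refl W))).trans
        { toFun := fun a => ((a.1.1, a.2), a.1.2)
          invFun := fun a => ((a.1.1, a.2), a.1.2)
          left_inv := fun _ => rfl
          right_inv := fun _ => rfl }) (fun r => addr r.1)

theorem cost_extend (f : T ≃ S × W) (q : QStep O S) : (q.extend f).cost = q.cost := by
  cases q <;> rfl

theorem act_extend (X : O.Contents) (f : T ≃ S × W) (q : QStep O S) (ψ : S → ℂ) (φ : W → ℂ) :
    (q.extend f).act X (fun t => ψ (f t).1 * φ (f t).2) =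
      fun t => q.act X ψ (f t).1 * φ (f t).2 := by
  funext t
  cases q with
  | gate U =>
    have h := liftGate_mulVec U (fun a : S × W => ψ a.1 * φ a.2) (f t).1 (f t).2
    have h2 := congrFun (act_smul X (.gate U) (φ (f t).2) ψ) (f t).1
    simp only [act] at h2
    simp only [extend, act]
    rw [← h2, ← h]
    simp only [Matrix.mulVec, dotProduct, Matrix.submatrix_apply, Prod.mk.eta]
    exact Equiv.sum_comp f (fun a => (liftGate (W := W) U : Matrix (S × W) (S × W) ℂ) (f t) a *
      (ψ a.1 * φ a.2))
  | query p R e addr => simp [act, extend]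

theorem foldl_act_extend (X : O.Contents) (f : T ≃ S × W) (l : List (QStep O S)) (ψ : S → ℂ)
    (φ : W → ℂ) :
    (l.map (extend f)).foldl (fun ψ q => q.act X ψ) (fun t => ψ (f t).1 * φ (f t).2) =
      fun t => l.foldl (fun ψ q => q.act X ψ) ψ (f t).1 * φ (f t).2 := by
  induction l generalizing ψ with
  | nil => rfl
  | cons q l ih => rw [List.map_cons, List.foldl_cons, act_extend, ih, List.foldl_cons]

end QStep

namespace QAlg

variable {O : OracleType} {β : Type}

theorem toOuterMeasure_dist (Q : QAlg O β) (X : O.Contents) (B : Set β) [DecidablePred (· ∈ B)] :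
    (Q.dist X).toOuterMeasure B =
      ENNReal.ofReal (∑ s with Q.out s ∈ B, ‖Q.final X s‖ ^ 2) := by
  rw [dist, PMF.toOuterMeasure_map_apply, measured, PMF.toOuterMeasure_ofFintype_apply,
    ENNReal.ofReal_sum_of_nonneg (fun s _ => by positivity), tsum_fintype, Finset.sum_filter]
  refine Finset.sum_congr rfl fun s _ => ?_
  by_cases h : Q.out s ∈ B <;> simp [h]

/-- The probability that the output is `false`. -/
noncomputable def missProb (Q : QAlg O Bool) (X : O.Contents) : ℝ :=
  ∑ s with Q.out s = false, ‖Q.final X s‖ ^ 2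

theorem missProb_nonneg (Q : QAlg O Bool) (X : O.Contents) : 0 ≤ Q.missProb X :=
  Finset.sum_nonneg fun _ _ => by positivity

theorem sum_out_true (Q : QAlg O Bool) (X : O.Contents) :
    ∑ s with Q.out s = true, ‖Q.final X s‖ ^ 2 = 1 - Q.missProb X := by
  rw [eq_sub_iff_add_eq, missProb, ← Q.sum_normSq_final X,
    ← Finset.sum_filter_add_sum_filter_not Finset.univ (fun s => Q.out s = true)]
  simp

theorem missProb_le_one (Q : QAlg O Bool) (X : O.Contents) : Q.missProb X ≤ 1 := by
  have : 0 ≤ 1 - Q.missProb X := by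
    rw [← sum_out_true]
    exact Finset.sum_nonneg fun _ _ => by positivity
  linarith

theorem toOuterMeasure_dist_ne_true (Q : QAlg O Bool) (X : O.Contents) :
    (Q.dist X).toOuterMeasure {b | b ≠ true} = ENNReal.ofReal (Q.missProb X) := by
  classical
  rw [toOuterMeasure_dist, missProb]
  simp

theorem toOuterMeasure_dist_ne_false (Q : QAlg O Bool) (X : O.Contents) :
    (Q.dist X).toOuterMeasure {b | b ≠ false} = ENNReal.ofReal (1 - Q.missProb X) := by
  classical
  rw [toOuterMeasure_dist, ← sum_out_true]
  simp

/-- The algorithm that runs `Q₁` and `Q₂` on separate registers and takes the disjunction of their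
outputs. -/
def or (Q₁ Q₂ : QAlg O Bool) : QAlg O Bool where
  S := Q₁.S × Q₂.S
  fin := inferInstance
  dec := inferInstance
  init := (Q₁.init, Q₂.init)
  steps := Q₁.steps.map (QStep.extend (Equiv.refl _)) ++
    Q₂.steps.map (QStep.extend (Equiv.prodComm _ _))
  out s := Q₁.out s.1 || Q₂.out s.2

theorem cost_or (Q₁ Q₂ : QAlg O Bool) : (Q₁.or Q₂).cost = Q₁.cost + Q₂.cost := by
  change ((Q₁.steps.map (QStep.extend (Equiv.refl _)) ++
    Q₂.steps.map (QStep.extend (Equiv.prodComm _ _))).map QStep.cost).sum = _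
  rw [List.map_append, List.map_map, List.map_map, List.sum_append, cost, cost]
  congr 3 <;> exact funext fun q => QStep.cost_extend _ q

theorem final_or (Q₁ Q₂ : QAlg O Bool) (X : O.Contents) (s : Q₁.S × Q₂.S) :
    (Q₁.or Q₂).final X s = Q₁.final X s.1 * Q₂.final X s.2 := by
  have h0 : (Pi.single (Q₁.init, Q₂.init) 1 : Q₁.S × Q₂.S → ℂ) =
      fun t => (Pi.single Q₁.init 1 : Q₁.S → ℂ) (Equiv.refl (Q₁.S × Q₂.S) t).1 *
        (Pi.single Q₂.init 1 : Q₂.S → ℂ) (Equiv.refl (Q₁.S × Q₂.S) t).2 := by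
    funext t
    rcases t with ⟨a, b⟩
    simp only [Pi.single_apply, Prod.mk.injEq, Equiv.refl_apply]
    split_ifs <;> simp_all
  have h1 := QStep.foldl_act_extend X (Equiv.refl (Q₁.S × Q₂.S)) Q₁.steps (Pi.single Q₁.init 1)
    (Pi.single Q₂.init 1)
  have h2 := QStep.foldl_act_extend X (Equiv.prodComm Q₁.S Q₂.S) Q₂.steps (Pi.single Q₂.init 1)
    (Q₁.final X)
  have h3 : (Q₁.or Q₂).final X = List.foldl (fun ψ q => q.act X ψ)
      (Pi.single (Q₁.init, Q₂.init) 1) (Q₁.steps.map (QStep.extend (Equiv.refl _)) ++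
    Q₂.steps.map (QStep.extend (Equiv.prodComm _ _))) := rfl
  rw [h3, List.foldl_append, h0, h1]
  have h4 := congrFun h2 s
  simp only [Equiv.prodComm_apply, Prod.fst_swap, Prod.snd_swap] at h4
  rw [mul_comm (Q₁.final X s.1)]
  refine Eq.trans (congrFun (congrArg (fun ψ => List.foldl _ ψ _) ?_) s) h4
  funext t
  exact mul_comm _ _

theorem missProb_or (Q₁ Q₂ : QAlg O Bool) (X : O.Contents) :
    (Q₁.or Q₂).missProb X = Q₁.missProb X * Q₂.missProb X := by
  calc (Q₁.or Q₂).missProb X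
      = ∑ s : Q₁.S × Q₂.S, if (Q₁.out s.1 || Q₂.out s.2) = false then
          ‖Q₁.final X s.1 * Q₂.final X s.2‖ ^ 2 else 0 := by
        rw [missProb, Finset.sum_filter]
        refine Finset.sum_congr rfl fun s _ => ?_
        exact congrArg (fun z : ℂ => if (Q₁.out s.1 || Q₂.out s.2) = false then ‖z‖ ^ 2 else 0)
          (final_or Q₁ Q₂ X s)
    _ = _ := by
        rw [missProb, missProb, Finset.sum_filter, Finset.sum_filter, Finset.sum_mul_sum,
          Fintype.sum_prod_type]
        refine Finset.sum_congr rfl fun a _ => Finset.sum_congr rfl fun b _ => ?_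
        cases Q₁.out a <;> cases Q₂.out b <;> simp [mul_pow]

/-- The algorithm that outputs `false` without a query. -/
def miss : QAlg O Bool where
  S := Unit
  fin := inferInstance
  dec := inferInstance
  init := ()
  steps := []
  out _ := false

/-- The disjunction of the outputs of independent runs of the algorithms in a list. -/
def any (l : List (QAlg O Bool)) : QAlg O Bool := l.foldr or miss

theorem cost_any (l : List (QAlg O Bool)) : (any l).cost = (l.map cost).sum := by
  induction l with
  | nil => rfl
  | cons Q l ih => rw [List.map_cons, List.sum_cons, ← ih, ← cost_or]; rfl

theorem missProb_any (l : List (QAlg O Bool)) (X : O.Contents) :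
    (any l).missProb X = (l.map fun Q => Q.missProb X).prod := by
  induction l with
  | nil =>
    change ∑ s : Unit with false = false, ‖(Pi.single () 1 : Unit → ℂ) s‖ ^ 2 = 1
    simp
  | cons Q l ih => rw [List.map_cons, List.prod_cons, ← ih, ← missProb_or]; rfl

theorem missProb_any_le {l : List (QAlg O Bool)} {Q : QAlg O Bool} (hQ : Q ∈ l)
    (X : O.Contents) : (any l).missProb X ≤ Q.missProb X := by
  induction l with
  | nil => simp at hQ
  | cons Q' l ih =>
    have h : (any (Q' :: l)).missProb X = Q'.missProb X * (any l).missProb X := missProb_or _ _ _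
    rw [h]
    rcases List.mem_cons.1 hQ with rfl | hQ
    · exact mul_le_of_le_one_right (missProb_nonneg _ _) (missProb_le_one _ _)
    · exact (mul_le_of_le_one_left (missProb_nonneg _ _) (missProb_le_one _ _)).trans (ih hQ)

theorem missProb_any_eq_one {l : List (QAlg O Bool)} {X : O.Contents}
    (h : ∀ Q ∈ l, Q.missProb X = 1) : (any l).missProb X = 1 := by
  rw [missProb_any]
  exact List.prod_eq_one (by simpa using h)

end QAlg

/-! ### Amplitude amplification -/

/-- The reflection `2 v vᵀ / ‖v‖² - 1` that fixes the line of a real vector `v` (for `v = 0` it is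
`-1`, as division by zero gives zero). -/
noncomputable def lineReflection {R : Type} [Fintype R] [DecidableEq R] (v : R → ℝ) :
    Matrix.unitaryGroup R ℂ :=
  ⟨Matrix.of fun r r' =>
    ((2 / (∑ a, v a ^ 2) * v r * v r' - if r = r' then 1 else 0 : ℝ) : ℂ), by
    rw [Matrix.mem_unitaryGroup_iff]
    ext r r'
    simp only [Matrix.mul_apply, Matrix.star_apply, Matrix.of_apply, Complex.star_def,
      Complex.conj_ofReal, Matrix.one_apply]
    rw [← Complex.ofReal_one, ← Complex.ofReal_zero, ← apply_ite Complex.ofReal]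
    simp only [← Complex.ofReal_mul, ← Complex.ofReal_sum]
    congr 1
    set N := ∑ a, v a ^ 2 with hN
    have h : ∀ a, (2 / N * v r * v a - if r = a then 1 else 0) *
        (2 / N * v r' * v a - if r' = a then 1 else 0) =
        (2 / N) ^ 2 * v r * v r' * v a ^ 2 - (if r = a then 2 / N * v r' * v a else 0)
          - (if r' = a then 2 / N * v r * v a else 0)
          + if r = a then (if r' = a then 1 else 0) else 0 := by
      intro a
      split_ifs <;> ring
    simp only [h, Finset.sum_add_distrib, Finset.sum_sub_distrib, ← Finset.mul_sum, ← hN,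
      Finset.sum_ite_eq, Finset.mem_univ, if_true]
    have h2 : (2 / N) ^ 2 * N = 2 * (2 / N) := by
      by_cases h0 : N = 0
      · simp [h0]
      · field_simp
    rw [if_congr (eq_comm (a := r) (b := r')) rfl rfl]
    linear_combination v r * v r' * h2⟩

theorem lineReflection_mulVec {R : Type} [Fintype R] [DecidableEq R] (v φ : R → ℝ) (r : R) :
    (lineReflection v : Matrix R R ℂ).mulVec (fun a => (φ a : ℂ)) r =
      ((2 / (∑ a, v a ^ 2) * (∑ a, v a * φ a) * v r - φ r : ℝ) : ℂ) := by
  simp only [lineReflection, Matrix.mulVec, dotProduct, Matrix.of_apply]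
  simp only [← Complex.ofReal_mul, ← Complex.ofReal_sum]
  congr 1
  simp only [sub_mul, Finset.sum_sub_distrib, ite_mul, one_mul, zero_mul, Finset.sum_ite_eq,
    Finset.mem_univ, if_true, Finset.mul_sum, Finset.sum_mul]
  congr 1
  exact Finset.sum_congr rfl fun a _ => by ring

/-- The start vector of the search: an address and an auxiliary bit, which is `true` with
probability `a`. -/
noncomputable def searchStart (d : ℕ) (a : ℝ) (r : Fin d × Bool) : ℝ :=
  √((if r.2 then a else 1 - a) / d)

theorem searchStart_sq {d : ℕ} {a : ℝ} (h0 : 0 ≤ a) (h1 : a ≤ 1) (r : Fin d × Bool) :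
    searchStart d a r ^ 2 = (if r.2 then a else 1 - a) / d := by
  refine Real.sq_sqrt (div_nonneg ?_ (Nat.cast_nonneg d))
  split_ifs <;> linarith

theorem sum_searchStart_sq {d : ℕ} [NeZero d] {a : ℝ} (h0 : 0 ≤ a) (h1 : a ≤ 1) :
    ∑ r, searchStart d a r ^ 2 = 1 := by
  have : (d : ℝ) ≠ 0 := Nat.cast_ne_zero.2 (NeZero.ne d)
  simp only [searchStart_sq h0 h1, Fintype.sum_prod_type, Fintype.sum_bool, if_true,
    Bool.false_eq_true, if_false, Finset.sum_const, Finset.card_univ, Fintype.card_fin,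
    nsmul_eq_mul]
  field_simp
  ring

/-- The query that adds the bit at the address to the answer register. -/
def bitQuery (d : ℕ) : QStep (BitOracle d) ((Fin d × Bool) × ZMod 2) :=
  .query () (Fin d × Bool) (Equiv.refl _) (fun r => r.1)

theorem act_bitQuery {d : ℕ} (x : Fin d → Bool) (ψ : (Fin d × Bool) × ZMod 2 → ℂ) :
    (bitQuery d).act (bitContents x) ψ = fun s => ψ (s.1, s.2 - bit (x s.1.1)) := rfl

/-- The gate that flips the sign where the auxiliary bit is `true` and the answer register holds
`target`. -/
def targetPhase (d : ℕ) (target : Bool) : Matrix.unitaryGroup ((Fin d × Bool) × ZMod 2) ℂ :=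
  ⟨Matrix.diagonal fun s => if s.1.2 = true ∧ s.2 = bit target then -1 else 1, by
    rw [Matrix.mem_unitaryGroup_iff, Matrix.star_eq_conjTranspose, Matrix.diagonal_conjTranspose,
      Matrix.diagonal_mul_diagonal, ← Matrix.diagonal_one]
    congr 1
    funext s
    simp only [Pi.star_apply]
    split_ifs <;> simp⟩

/-- One round of amplitude amplification: the phase of the targets, computed by a query that is
undone afterwards, and the reflection in the start vector. -/
noncomputable def amplifyRound (d : ℕ) (a : ℝ) (target : Bool) :
    List (QStep (BitOracle d) ((Fin d × Bool) × ZMod 2)) :=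
  [bitQuery d, .gate (targetPhase d target), bitQuery d,
    .gate (liftGate (lineReflection (searchStart d a)))]

/-- Prepares the start vector, performs `j` rounds of amplitude amplification, and checks with a
last query whether the bit at the measured address is `target`. The start vector `u` is prepared
from a basis vector `e` by the reflection that fixes `u + e`. -/
noncomputable def amplify (d : ℕ) [NeZero d] (a : ℝ) (target : Bool) (j : ℕ) :
    QAlg (BitOracle d) Bool where
  S := (Fin d × Bool) × ZMod 2
  fin := inferInstance
  dec := inferInstance
  init := ((0, false), 0)
  steps := .gate (liftGate (lineReflection fun r =>
      searchStart d a r + if r = (0, false) then 1 else 0)) ::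
    ((List.replicate j (amplifyRound d a target)).flatten ++ [bitQuery d])
  out s := decide (s.2 = bit target)

section

variable {d : ℕ}

theorem cost_amplify [NeZero d] (a : ℝ) (target : Bool) (j : ℕ) : (amplify d a target j).cost = 2 * j + 1 := by
  have h : ((List.replicate j (amplifyRound d a target)).flatten.map QStep.cost).sum = 2 * j := by
    induction j with
    | zero => rfl
    | succ j ih =>
      rw [List.replicate_succ, List.flatten_cons, List.map_append, List.sum_append, ih]
      simp [amplifyRound, bitQuery, QStep.cost]
      ring
  change ((QStep.gate (O := BitOracle d) (liftGate (lineReflection _)) ::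
    ((List.replicate j (amplifyRound d a target)).flatten ++ [bitQuery d])).map QStep.cost).sum = _
  rw [List.map_cons, List.map_append, List.sum_cons, List.sum_append, h]
  simp [bitQuery, QStep.cost]

/-- The state with amplitudes `φ` on the address register and `0` in the answer register. -/
def cleanState (φ : Fin d × Bool → ℝ) : (Fin d × Bool) × ZMod 2 → ℂ :=
  fun s => if s.2 = 0 then (φ s.1 : ℂ) else 0

theorem act_lift_cleanState (X : (BitOracle d).Contents) (v φ : Fin d × Bool → ℝ) :
    (QStep.gate (liftGate (lineReflection v))).act X (cleanState φ) =
      cleanState fun r => 2 / (∑ a, v a ^ 2) * (∑ a, v a * φ a) * v r - φ r := by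
  funext ⟨r, b⟩
  refine (liftGate_mulVec _ _ _ _).trans ?_
  by_cases hb : b = 0
  · subst hb
    simp only [cleanState, if_true]
    exact lineReflection_mulVec v φ r
  · simp only [cleanState, if_neg hb]
    exact congrFun (Matrix.mulVec_zero _) r

variable (x : Fin d → Bool)

theorem prepare_searchStart [NeZero d] {a : ℝ} (h0 : 0 ≤ a) (h1 : a ≤ 1) :
    (QStep.gate (liftGate (lineReflection fun r =>
      searchStart d a r + if r = (0, false) then 1 else 0))).act (bitContents x)
      (Pi.single ((0, false), 0) 1) = cleanState (searchStart d a) := by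
  set e : Fin d × Bool → ℝ := fun r => if r = (0, false) then 1 else 0 with he
  have hinit : (Pi.single ((0, false), 0) 1 : (Fin d × Bool) × ZMod 2 → ℂ) = cleanState e := by
    funext ⟨r, b⟩
    simp only [Pi.single_apply, cleanState, Prod.mk.injEq, he]
    split_ifs <;> simp_all
  rw [hinit]
  refine (act_lift_cleanState _ _ _).trans ?_
  congr 1
  funext r
  have hn : 0 ≤ searchStart d a (0, false) := Real.sqrt_nonneg _
  have hdot : ∑ b, (searchStart d a b + e b) * e b = searchStart d a (0, false) + 1 := by
    rw [Finset.sum_eq_single (0, false)]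
    · simp [he]
    · intro b _ hb
      simp [he, hb]
    · simp
  have hsq : ∑ b, (searchStart d a b + e b) ^ 2 = 2 * (searchStart d a (0, false) + 1) := by
    have : ∀ b, (searchStart d a b + e b) ^ 2 =
        searchStart d a b ^ 2 + (if b = (0, false) then 2 * searchStart d a b + 1 else 0) := by
      intro b
      simp only [he]
      split_ifs <;> ring
    simp only [this, Finset.sum_add_distrib, sum_searchStart_sq h0 h1, Finset.sum_ite_eq',
      Finset.mem_univ, if_true]
    ring
  rw [hdot, hsq]
  field_simp
  ring

/-- The pairs whose phase is flipped. -/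
abbrev IsTarget (target : Bool) (r : Fin d × Bool) : Prop := r.2 = true ∧ x r.1 = target

theorem bit_inj {a b : Bool} : bit a = bit b ↔ a = b := by
  cases a <;> cases b <;> decide

theorem act_phase_cleanState (target : Bool) (φ : Fin d × Bool → ℝ) :
    (bitQuery d).act (bitContents x) ((QStep.gate (targetPhase d target)).act (bitContents x)
      ((bitQuery d).act (bitContents x) (cleanState φ))) =
      cleanState fun r => if IsTarget x target r then -φ r else φ r := by
  funext ⟨r, b⟩
  rw [act_bitQuery, act_bitQuery]
  simp only [QStep.act, targetPhase, Matrix.mulVec_diagonal]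
  have h2 : b - bit (x r.1) - bit (x r.1) = b := by
    rw [sub_sub, CharTwo.add_self_eq_zero, sub_zero]
  by_cases hb : b = 0
  · subst hb
    have h3 : (0 : ZMod 2) - bit (x r.1) = bit (x r.1) := by
      rw [zero_sub, CharTwo.neg_eq]
    simp only [cleanState, h3, sub_self, if_true, bit_inj, IsTarget]
    split_ifs <;> simp
  · simp [cleanState, h2, hb]

theorem sum_isTarget {a : ℝ} (h0 : 0 ≤ a) (h1 : a ≤ 1) (target : Bool) :
    ∑ r with IsTarget x target r, searchStart d a r ^ 2 =
      a * (Finset.univ.filter fun z => x z = target).card / d := by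
  simp only [searchStart_sq h0 h1, Finset.sum_filter, Fintype.sum_prod_type, Fintype.sum_bool,
    IsTarget, true_and, Bool.false_eq_true, false_and, if_false, add_zero, if_true]
  rw [← Finset.sum_filter, Finset.sum_const, nsmul_eq_mul]
  ring

/-- The rotation by `2 θ` in the plane of the two halves of the start vector; the amplitudes are
given up to the factors `sin θ` and `cos θ`, which may vanish. -/
theorem foldl_amplifyRound [NeZero d] {a θ : ℝ} (h0 : 0 ≤ a) (h1 : a ≤ 1) (target : Bool)
    (hθ : ∑ r with IsTarget x target r, searchStart d a r ^ 2 = Real.sin θ ^ 2) (j : ℕ) :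
    ∃ A B : ℝ, Real.sin θ * A = Real.sin ((2 * j + 1) * θ) ∧
      Real.cos θ * B = Real.cos ((2 * j + 1) * θ) ∧
      (List.replicate j (amplifyRound d a target)).flatten.foldl
        (fun ψ q => q.act (bitContents x) ψ) (cleanState (searchStart d a)) =
      cleanState fun r => (if IsTarget x target r then A else B) * searchStart d a r := by
  induction j with
  | zero => exact ⟨1, 1, by simp, by simp, by simp⟩
  | succ j ih =>
    obtain ⟨A, B, hA, hB, h⟩ := ih
    refine ⟨A * Real.cos (2 * θ) + 2 * Real.cos θ ^ 2 * B,
      B * Real.cos (2 * θ) - 2 * Real.sin θ ^ 2 * A, ?_, ?_, ?_⟩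
    · have : (2 * ((j + 1 : ℕ) : ℝ) + 1) * θ = (2 * j + 1) * θ + 2 * θ := by push_cast; ring
      rw [this, Real.sin_add, ← hA, ← hB, Real.sin_two_mul]
      ring
    · have : (2 * ((j + 1 : ℕ) : ℝ) + 1) * θ = (2 * j + 1) * θ + 2 * θ := by push_cast; ring
      rw [this, Real.cos_add, ← hA, ← hB, Real.sin_two_mul]
      ring
    · rw [List.replicate_succ', List.flatten_append, List.foldl_append, h]
      simp only [amplifyRound, List.flatten_cons, List.flatten_nil, List.append_nil,
        List.foldl_cons, List.foldl_nil]
      rw [act_phase_cleanState, act_lift_cleanState, sum_searchStart_sq h0 h1]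
      have hcompl : ∑ r with ¬ IsTarget x target r, searchStart d a r ^ 2 = Real.cos θ ^ 2 := by
        have := Finset.sum_filter_add_sum_filter_not Finset.univ (IsTarget x target)
          (fun r => searchStart d a r ^ 2)
        rw [sum_searchStart_sq h0 h1, hθ] at this
        linarith [Real.sin_sq_add_cos_sq θ]
      have hdot : ∑ r, searchStart d a r * (if IsTarget x target r then
          -((if IsTarget x target r then A else B) * searchStart d a r)
          else (if IsTarget x target r then A else B) * searchStart d a r) =
          -A * Real.sin θ ^ 2 + B * Real.cos θ ^ 2 := by
        rw [← hθ, ← hcompl, Finset.mul_sum, Finset.mul_sum, Finset.sum_filter, Finset.sum_filter,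
          ← Finset.sum_add_distrib]
        refine Finset.sum_congr rfl fun r _ => ?_
        split_ifs <;> ring
      rw [hdot]
      congr 1
      funext r
      have hc := Real.cos_two_mul θ
      have hs := Real.sin_sq_add_cos_sq θ
      split_ifs
      · linear_combination (-A * searchStart d a r) * hc + (-2 * A * searchStart d a r) * hs
      · linear_combination (-B * searchStart d a r) * hc

theorem final_amplify [NeZero d] {a : ℝ} (h0 : 0 ≤ a) (h1 : a ≤ 1) (target : Bool) (j : ℕ) :
    (amplify d a target j).final (bitContents x) = (bitQuery d).act (bitContents x)
      ((List.replicate j (amplifyRound d a target)).flatten.foldl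
        (fun ψ q => q.act (bitContents x) ψ) (cleanState (searchStart d a))) := by
  rw [← prepare_searchStart x h0 h1]
  change List.foldl (fun ψ q => QStep.act (bitContents x) q ψ)
    (Pi.single ((0, false), 0) 1 : (Fin d × Bool) × ZMod 2 → ℂ)
    (_ :: (_ ++ [bitQuery d])) = _
  rw [List.foldl_cons, List.foldl_append]
  rfl

/-- The outcomes that miss the target, among those with nonzero amplitude, are the addresses of
other bits. -/
theorem missProb_amplify_eq [NeZero d] {a : ℝ} (h0 : 0 ≤ a) (h1 : a ≤ 1) (target : Bool) (j : ℕ)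
    (φ : Fin d × Bool → ℝ)
    (h : (List.replicate j (amplifyRound d a target)).flatten.foldl
        (fun ψ q => q.act (bitContents x) ψ) (cleanState (searchStart d a)) = cleanState φ) :
    (amplify d a target j).missProb (bitContents x) =
      ∑ r : Fin d × Bool, if x r.1 = target then 0 else φ r ^ 2 := by
  have hf := final_amplify x h0 h1 target j
  rw [h, act_bitQuery] at hf
  calc _ = ∑ s : (Fin d × Bool) × ZMod 2, if decide (s.2 = bit target) = false then
        ‖cleanState φ (s.1, s.2 - bit (x s.1.1))‖ ^ 2 else 0 := by
        rw [QAlg.missProb, Finset.sum_filter]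
        exact Finset.sum_congr rfl fun s _ => congrArg
          (fun ψ : (Fin d × Bool) × ZMod 2 → ℂ =>
            if decide (Prod.snd s = bit target) = false then ‖ψ s‖ ^ 2 else 0) hf
    _ = _ := by
        rw [Fintype.sum_prod_type]
        refine Finset.sum_congr rfl fun r _ => ?_
        rw [Finset.sum_eq_single (bit (x r.1))]
        · simp only [cleanState, sub_self, if_true, decide_eq_false_iff_not, bit_inj]
          split_ifs <;> simp_all
        · intro b _ hb
          simp [cleanState, sub_eq_zero, hb]
        · simp

theorem missProb_amplify_le [NeZero d] {a θ : ℝ} (h0 : 0 ≤ a) (h1 : a ≤ 1) (target : Bool)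
    (hθ : a * (Finset.univ.filter fun z => x z = target).card / d = Real.sin θ ^ 2) (j : ℕ) :
    (amplify d a target j).missProb (bitContents x) ≤ Real.cos ((2 * j + 1) * θ) ^ 2 := by
  rw [← sum_isTarget x h0 h1] at hθ
  obtain ⟨A, B, -, hB, h⟩ := foldl_amplifyRound x h0 h1 target hθ j
  have hcompl : ∑ r with ¬ IsTarget x target r, searchStart d a r ^ 2 = Real.cos θ ^ 2 := by
    have := Finset.sum_filter_add_sum_filter_not Finset.univ (IsTarget x target)
      (fun r => searchStart d a r ^ 2)
    rw [sum_searchStart_sq h0 h1, hθ] at this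
    linarith [Real.sin_sq_add_cos_sq θ]
  rw [missProb_amplify_eq x h0 h1 target j _ h, ← hB, mul_pow, ← hcompl, Finset.sum_mul,
    Finset.sum_filter]
  refine Finset.sum_le_sum fun r _ => ?_
  by_cases hr : x r.1 = target
  · rw [if_pos hr]
    split_ifs <;> positivity
  · have : ¬ IsTarget x target r := fun h => hr h.2
    rw [if_neg hr, if_neg this, if_pos this]
    exact le_of_eq (by ring)

theorem missProb_amplify_eq_one [NeZero d] {a : ℝ} (h0 : 0 ≤ a) (h1 : a ≤ 1) (target : Bool) (j : ℕ)
    (hx : ∀ z, x z ≠ target) : (amplify d a target j).missProb (bitContents x) = 1 := by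
  have hθ : ∑ r with IsTarget x target r, searchStart d a r ^ 2 = Real.sin 0 ^ 2 := by
    rw [Finset.filter_false_of_mem fun r _ h => hx _ h.2]
    simp
  obtain ⟨A, B, -, hB, h⟩ := foldl_amplifyRound x h0 h1 target hθ j
  have hB1 : B = 1 := by simpa using hB
  rw [missProb_amplify_eq x h0 h1 target j _ h, ← sum_searchStart_sq (d := d) h0 h1]
  refine Finset.sum_congr rfl fun r _ => ?_
  rw [if_neg (hx _), if_neg fun h => hx _ h.2, hB1, one_mul]

end

/-! ### Search for a known number of targets -/

theorem sum_inv_sqrt_le (m : ℕ) : ∑ t ∈ Finset.range m, 1 / √((t : ℝ) + 1) ≤ 2 * √(m : ℝ) := by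
  induction m with
  | zero => simp
  | succ m ih =>
    rw [Finset.sum_range_succ]
    have h0 : 0 ≤ √(m : ℝ) := Real.sqrt_nonneg _
    have h1 : 0 < √((m : ℝ) + 1) := Real.sqrt_pos.2 (by positivity)
    have h2 : √(m : ℝ) ^ 2 = m := Real.sq_sqrt (by positivity)
    have h3 : √((m : ℝ) + 1) ^ 2 = m + 1 := Real.sq_sqrt (by positivity)
    have h4 : 1 / √((m : ℝ) + 1) ≤ 2 * √((m : ℝ) + 1) - 2 * √(m : ℝ) := by
      rw [div_le_iff₀ h1]
      nlinarith [sq_nonneg (√((m : ℝ) + 1) - √(m : ℝ))]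
    push_cast
    linarith

theorem sum_map_range (n : ℕ) (f : ℕ → ℕ) :
    ((List.range n).map f).sum = ∑ i ∈ Finset.range n, f i := by
  induction n with
  | zero => rfl
  | succ n ih => rw [List.sum_range_succ, Finset.sum_range_succ, ih]

section

variable (d : ℕ)

/-- The angle that `j` rounds of amplification turn into a right angle. -/
noncomputable def rightAngle (j : ℕ) : ℝ := Real.pi / (2 * (2 * j + 1))

/-- The number of rounds for `t` targets among `d` bits. -/
noncomputable def tunedRounds (t : ℕ) : ℕ := ⌈√((d : ℝ) / t)⌉₊

/-- The search that succeeds with certainty if there are exactly `t` targets: the weight of the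
auxiliary bit lowers the initial amplitude of the targets to the sine of an angle that the rounds
turn into exactly a right angle. -/
noncomputable def tunedSearch [NeZero d] (target : Bool) (t : ℕ) : QAlg (BitOracle d) Bool :=
  amplify d (Real.sin (rightAngle (tunedRounds d t)) ^ 2 * d / t) target (tunedRounds d t)

variable {d}

theorem tunedWeight_le_one (t : ℕ) :
    Real.sin (rightAngle (tunedRounds d t)) ^ 2 * d / t ≤ 1 := by
  set θ := rightAngle (tunedRounds d t) with hθ
  have hj : √((d : ℝ) / t) ≤ tunedRounds d t := Nat.le_ceil _
  have hpos : 0 < 2 * (tunedRounds d t : ℝ) + 1 := by positivity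
  have hθ0 : 0 ≤ θ := by rw [hθ, rightAngle]; positivity
  have h1 : θ * (2 * tunedRounds d t + 1) = Real.pi / 2 := by
    rw [hθ, rightAngle]; field_simp
  have h2 : θ * √((d : ℝ) / t) ≤ 1 := by
    nlinarith [Real.pi_le_four, mul_le_mul_of_nonneg_left hj hθ0]
  have h3 : Real.sin θ ^ 2 ≤ θ ^ 2 := sq_le_sq.2 (by
    rw [abs_of_nonneg hθ0]
    exact (Real.abs_sin_le_abs).trans_eq (abs_of_nonneg hθ0))
  calc Real.sin θ ^ 2 * d / t = Real.sin θ ^ 2 * (d / t) := by ring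
    _ ≤ θ ^ 2 * (d / t) := by gcongr
    _ = (θ * √((d : ℝ) / t)) ^ 2 := by rw [mul_pow, Real.sq_sqrt (by positivity)]
    _ ≤ 1 := pow_le_one₀ (by positivity) h2

theorem missProb_tunedSearch [NeZero d] (x : Fin d → Bool) (target : Bool) {t : ℕ} (ht : 1 ≤ t)
    (hx : (Finset.univ.filter fun z => x z = target).card = t) :
    (tunedSearch d target t).missProb (bitContents x) = 0 := by
  have hd : (d : ℝ) ≠ 0 := Nat.cast_ne_zero.2 (NeZero.ne d)
  have ht' : (t : ℝ) ≠ 0 := by positivity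
  refine le_antisymm ?_ (QAlg.missProb_nonneg _ _)
  refine (missProb_amplify_le x (by positivity) (tunedWeight_le_one t) target
    (θ := rightAngle (tunedRounds d t)) ?_ _).trans_eq ?_
  · rw [hx]
    field_simp
  · have : (2 * (tunedRounds d t : ℝ) + 1) * rightAngle (tunedRounds d t) = Real.pi / 2 := by
      rw [rightAngle]; field_simp
    rw [this, Real.cos_pi_div_two]
    norm_num

theorem cost_tunedSearch_le [NeZero d] (target : Bool) {t : ℕ} (ht : 1 ≤ t) (htd : t ≤ d) :
    ((tunedSearch d target t).cost : ℝ) ≤ 5 * √(d : ℝ) * (1 / √(t : ℝ)) := by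
  have ht' : (0 : ℝ) < t := by positivity
  have h1 : (1 : ℝ) ≤ √((d : ℝ) / t) :=
    Real.one_le_sqrt.2 ((one_le_div ht').2 (by exact_mod_cast htd))
  have h2 : (tunedRounds d t : ℝ) < √((d : ℝ) / t) + 1 := Nat.ceil_lt_add_one (Real.sqrt_nonneg _)
  have h3 : 5 * √(d : ℝ) * (1 / √(t : ℝ)) = 5 * √((d : ℝ) / t) := by
    rw [Real.sqrt_div (by positivity)]; ring
  rw [tunedSearch, cost_amplify, h3]
  push_cast
  linarith

/-! ### Search for an unknown large number of targets -/

theorem two_mul_pow_three_div_two (l : ℕ) : 2 * (3 ^ l / 2) + 1 = 3 ^ l :=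
  Nat.two_mul_div_two_add_one_of_odd (Odd.pow (by decide))

/-- Tripling brings every angle of the first quadrant to within `π / 4` of a right angle. -/
theorem exists_cos_pow_three_mul_sq_le {θ : ℝ} (h0 : 0 < θ) (h1 : θ ≤ Real.pi / 2) :
    ∃ l : ℕ, Real.cos (3 ^ l * θ) ^ 2 ≤ 1 / 2 ∧ (l = 0 ∨ 3 ^ l * θ ≤ 3) := by
  have hex : ∃ l : ℕ, Real.pi / 4 < 3 ^ l * θ := by
    obtain ⟨l, hl⟩ := pow_unbounded_of_one_lt (Real.pi / 4 / θ) (by norm_num : (1 : ℝ) < 3)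
    exact ⟨l, (div_lt_iff₀ h0).1 hl⟩
  classical
  have hlow := Nat.find_spec hex
  have hup : 3 ^ Nat.find hex * θ ≤ 3 * Real.pi / 4 ∧
      (Nat.find hex = 0 ∨ 3 ^ Nat.find hex * θ ≤ 3) := by
    rcases Nat.eq_zero_or_pos (Nat.find hex) with hz | hpos
    · rw [hz]
      exact ⟨by linarith [Real.pi_pos], Or.inl rfl⟩
    · have := Nat.find_min hex (Nat.sub_lt hpos one_pos)
      obtain ⟨l, hl⟩ := Nat.exists_eq_succ_of_ne_zero hpos.ne'
      rw [hl, Nat.succ_sub_one, not_lt] at this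
      rw [hl, pow_succ]
      exact ⟨by linarith, Or.inr (by linarith [Real.pi_le_four])⟩
  refine ⟨Nat.find hex, ?_, hup.2⟩
  rw [Real.cos_sq]
  have := Real.cos_nonpos_of_pi_div_two_le_of_le
    (x := 2 * (3 ^ Nat.find hex * θ)) (by linarith) (by linarith [hup.1])
  linarith

variable (d) in
/-- The number of exponents `l` for which `3 ^ l` is at most about `3 √(d / k)`. -/
noncomputable def numScales (k : ℕ) : ℕ := Nat.log 3 ⌊3 * √((d : ℝ) / k)⌋₊ + 1

theorem pow_le_of_lt_numScales {k l : ℕ} (hk : 1 ≤ k) (hkd : k ≤ d) (hl : l < numScales d k) :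
    (3 : ℝ) ^ l ≤ 3 * √((d : ℝ) / k) := by
  have hk' : (0 : ℝ) < k := by positivity
  have h1 : (1 : ℝ) ≤ √((d : ℝ) / k) :=
    Real.one_le_sqrt.2 ((one_le_div hk').2 (by exact_mod_cast hkd))
  have hfl : ⌊3 * √((d : ℝ) / k)⌋₊ ≠ 0 := (Nat.floor_pos.2 (by linarith)).ne'
  have h2 : 3 ^ l ≤ ⌊3 * √((d : ℝ) / k)⌋₊ := Nat.pow_le_of_le_log hfl (Nat.lt_succ_iff.1 hl)
  calc (3 : ℝ) ^ l = ((3 ^ l : ℕ) : ℝ) := by push_cast; rfl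
    _ ≤ (⌊3 * √((d : ℝ) / k)⌋₊ : ℝ) := by exact_mod_cast h2
    _ ≤ _ := Nat.floor_le (by positivity)

theorem lt_numScales {k l : ℕ} (h : (3 : ℝ) ^ l ≤ 3 * √((d : ℝ) / k)) : l < numScales d k :=
  Nat.lt_succ_of_le (Nat.le_log_of_pow_le (by norm_num) (Nat.le_floor (by exact_mod_cast h)))

/-- If there are at least `k` targets, one of the searches with `3 ^ l` queries,
`l < numScales d k`, succeeds with probability at least one half. -/
theorem exists_missProb_le_half [NeZero d] (x : Fin d → Bool) (target : Bool) {k : ℕ} (hk : 1 ≤ k)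
    (hx : k ≤ (Finset.univ.filter fun z => x z = target).card) :
    ∃ l < numScales d k, (amplify d 1 target (3 ^ l / 2)).missProb (bitContents x) ≤ 1 / 2 := by
  set t := (Finset.univ.filter fun z => x z = target).card with ht
  have htd : t ≤ d := (Finset.card_le_univ _).trans_eq (Fintype.card_fin d)
  have hd : (0 : ℝ) < d := Nat.cast_pos.2 (NeZero.pos d)
  have hk' : (0 : ℝ) < k := by positivity
  have hkt : (k : ℝ) ≤ t := by exact_mod_cast hx
  have htd' : (t : ℝ) ≤ d := by exact_mod_cast htd
  have hs0 : 0 < √((t : ℝ) / d) := Real.sqrt_pos.2 (div_pos (by linarith) hd)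
  have hs1 : √((t : ℝ) / d) ≤ 1 := Real.sqrt_le_one.2 ((div_le_one hd).2 htd')
  set θ := Real.arcsin √((t : ℝ) / d) with hθ
  have hsin : Real.sin θ = √((t : ℝ) / d) := Real.sin_arcsin (by linarith) hs1
  have hθ0 : 0 < θ := Real.arcsin_pos.2 hs0
  obtain ⟨l, hcos, hl⟩ := exists_cos_pow_three_mul_sq_le hθ0 (Real.arcsin_le_pi_div_two _)
  refine ⟨l, lt_numScales ?_, ?_⟩
  · rcases hl with rfl | hl
    · have : (1 : ℝ) ≤ √((d : ℝ) / k) := Real.one_le_sqrt.2 ((one_le_div hk').2 (hkt.trans htd'))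
      rw [pow_zero]
      linarith
    · have h1 : √((t : ℝ) / d) ≤ θ := hsin ▸ Real.sin_le hθ0.le
      have h2 : √((k : ℝ) / d) * √((d : ℝ) / k) = 1 := by
        rw [← Real.sqrt_mul (by positivity), div_mul_div_cancel₀ hd.ne', div_self hk'.ne',
          Real.sqrt_one]
      have h3 : √((k : ℝ) / d) ≤ θ := (Real.sqrt_le_sqrt (by gcongr)).trans h1
      calc (3 : ℝ) ^ l = 3 ^ l * √((k : ℝ) / d) * √((d : ℝ) / k) := by rw [mul_assoc, h2, mul_one]
        _ ≤ 3 ^ l * θ * √((d : ℝ) / k) := by gcongr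
        _ ≤ _ := by gcongr
  · have h := missProb_amplify_le x zero_le_one le_rfl target (θ := θ) (by
      rw [hsin, Real.sq_sqrt (by positivity), one_mul]) (3 ^ l / 2)
    have h3 : (2 * ((3 ^ l / 2 : ℕ) : ℝ) + 1) = 3 ^ l := by
      exact_mod_cast two_mul_pow_three_div_two l
    rw [h3] at h
    exact h.trans hcos

/-! ### Boosted search and boosted gates -/

variable (d) in
/-- The boosted search for a bit equal to `target`: one run tuned to every number of targets up to
`k`, and `k` runs on every scale of larger numbers. -/
noncomputable def boostedSearch [NeZero d] (target : Bool) (k : ℕ) : QAlg (BitOracle d) Bool :=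
  QAlg.any ((List.range (min k d)).map (fun t => tunedSearch d target (t + 1)) ++
    if k ≤ d then (List.range (numScales d k)).map fun l =>
      QAlg.any (List.replicate k (amplify d 1 target (3 ^ l / 2))) else [])

theorem cost_boostedSearch_le [NeZero d] (target : Bool) {k : ℕ} (hk : 1 ≤ k) :
    ((boostedSearch d target k).cost : ℝ) ≤ 15 * √((k : ℝ) * d) := by
  have hk' : (0 : ℝ) < k := by positivity
  -- `∑ 5 √(d / t) ≤ 10 √(k d)` over the tuned runs.
  have h1 : ((((List.range (min k d)).map fun t => tunedSearch d target (t + 1)).map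
      QAlg.cost).sum : ℝ) ≤ 10 * √((k : ℝ) * d) := by
    rw [List.map_map, sum_map_range]
    push_cast
    calc ∑ t ∈ Finset.range (min k d), ((tunedSearch d target (t + 1)).cost : ℝ)
        ≤ ∑ t ∈ Finset.range (min k d), 5 * √(d : ℝ) * (1 / √((t : ℝ) + 1)) := by
          refine Finset.sum_le_sum fun t ht => ?_
          have := cost_tunedSearch_le (d := d) target (t := t + 1) (by omega)
            (by have := Finset.mem_range.1 ht; omega)
          exact_mod_cast this
      _ ≤ 5 * √(d : ℝ) * (2 * √((min k d : ℕ) : ℝ)) := by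
          rw [← Finset.mul_sum]
          gcongr
          exact sum_inv_sqrt_le _
      _ ≤ 5 * √(d : ℝ) * (2 * √(k : ℝ)) := by
          gcongr
          exact min_le_left _ _
      _ = 10 * √((k : ℝ) * d) := by
          rw [Real.sqrt_mul (by positivity)]
          ring
  -- A geometric series: `k` runs on each scale, the largest of at most `3 √(d / k)` queries.
  have h2 : ((((if k ≤ d then (List.range (numScales d k)).map fun l =>
      QAlg.any (List.replicate k (amplify d 1 target (3 ^ l / 2))) else []).map
      QAlg.cost).sum : ℕ) : ℝ) ≤ 5 * √((k : ℝ) * d) := by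
    split_ifs with hkd
    · rw [List.map_map, sum_map_range]
      have hc : ∀ l, (QAlg.cost ∘ fun l =>
          QAlg.any (List.replicate k (amplify d 1 target (3 ^ l / 2)))) l = k * 3 ^ l := by
        intro l
        simp [QAlg.cost_any, cost_amplify, two_mul_pow_three_div_two]
      simp only [hc]
      push_cast
      have hlast := pow_le_of_lt_numScales (d := d) hk hkd (Nat.lt_succ_self _)
      have hpow : (3 : ℝ) ^ numScales d k ≤ 9 * √((d : ℝ) / k) := by
        rw [numScales, pow_succ]
        linarith
      have hkk : (k : ℝ) * √((d : ℝ) / k) = √((k : ℝ) * d) := by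
        rw [Real.sqrt_div (by positivity), Real.sqrt_mul (by positivity)]
        have := Real.sq_sqrt hk'.le
        field_simp
        rw [this, mul_comm]
      rw [← Finset.mul_sum, geom_sum_eq (by norm_num)]
      have := mul_le_mul_of_nonneg_left hpow hk'.le
      have h0 := Real.sqrt_nonneg ((k : ℝ) * d)
      linarith
    · simpa using mul_nonneg (Real.sqrt_nonneg _) (Real.sqrt_nonneg _)
  rw [boostedSearch, QAlg.cost_any, List.map_append, List.sum_append]
  push_cast at h1 h2 ⊢
  linarith

theorem missProb_boostedSearch_eq_one [NeZero d] (x : Fin d → Bool) (target : Bool) (k : ℕ)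
    (hx : ∀ z, x z ≠ target) : (boostedSearch d target k).missProb (bitContents x) = 1 := by
  refine QAlg.missProb_any_eq_one fun Q hQ => ?_
  rcases List.mem_append.1 hQ with hQ | hQ
  · obtain ⟨t, -, rfl⟩ := List.mem_map.1 hQ
    exact missProb_amplify_eq_one x (by positivity) (tunedWeight_le_one _) target _ hx
  · split_ifs at hQ
    · obtain ⟨l, -, rfl⟩ := List.mem_map.1 hQ
      refine QAlg.missProb_any_eq_one fun Q hQ => ?_
      rw [List.eq_of_mem_replicate hQ]
      exact missProb_amplify_eq_one x zero_le_one le_rfl target _ hx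
    · simp at hQ

theorem missProb_boostedSearch_le [NeZero d] (x : Fin d → Bool) (target : Bool) {k : ℕ} (hk : 1 ≤ k)
    (hx : ∃ z, x z = target) :
    (boostedSearch d target k).missProb (bitContents x) ≤ 1 / 2 ^ k := by
  set t := (Finset.univ.filter fun z => x z = target).card with ht
  have htd : t ≤ d := (Finset.card_le_univ _).trans_eq (Fintype.card_fin d)
  have ht1 : 1 ≤ t := by
    obtain ⟨z, hz⟩ := hx
    exact Finset.card_pos.2 ⟨z, by simp [hz]⟩
  by_cases htk : t ≤ k
  · refine (QAlg.missProb_any_le (List.mem_append_left _ (List.mem_map.2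
      ⟨t - 1, List.mem_range.2 (by omega), rfl⟩)) _).trans ?_
    rw [Nat.sub_add_cancel ht1, missProb_tunedSearch x target ht1 ht.symm]
    positivity
  · obtain ⟨l, hl, hmiss⟩ := exists_missProb_le_half x target hk (le_of_not_ge htk)
    refine (QAlg.missProb_any_le (List.mem_append_right _ (by
      rw [if_pos (by omega)]
      exact List.mem_map.2 ⟨l, List.mem_range.2 hl, rfl⟩)) _).trans ?_
    rw [QAlg.missProb_any, List.map_replicate, List.prod_replicate, ← one_div_pow]
    exact pow_le_pow_left₀ (QAlg.missProb_nonneg _ _) hmiss k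

/-- The output of the boosted search tells whether there is a target. -/
theorem boostedSearch_error_le [NeZero d] (x : Fin d → Bool) (target : Bool) {k : ℕ} (hk : 1 ≤ k) :
    ((boostedSearch d target k).dist (bitContents x)).toOuterMeasure
      {b | b ≠ decide (∃ z, x z = target)} ≤ ENNReal.ofReal (1 / 2 ^ k) := by
  by_cases hx : ∃ z, x z = target
  · rw [decide_eq_true hx, QAlg.toOuterMeasure_dist_ne_true]
    exact ENNReal.ofReal_le_ofReal (missProb_boostedSearch_le x target hk hx)
  · rw [decide_eq_false hx, QAlg.toOuterMeasure_dist_ne_false,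
      missProb_boostedSearch_eq_one x target k (not_exists.1 hx)]
    simp

end

namespace QAlg

variable {O : OracleType}

/-- The algorithm with the negated output. -/
def negate (Q : QAlg O Bool) : QAlg O Bool := { Q with out := fun s => !Q.out s }

theorem toOuterMeasure_dist_negate (Q : QAlg O Bool) (X : O.Contents) (v : Bool) :
    (Q.negate.dist X).toOuterMeasure {b | b ≠ !v} = (Q.dist X).toOuterMeasure {b | b ≠ v} := by
  have h : Q.negate.dist X = (Q.dist X).map not := by
    rw [QAlg.dist, QAlg.dist, PMF.map_comp]
    rfl
  rw [h, PMF.toOuterMeasure_map_apply]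
  congr 1
  ext b
  cases b <;> cases v <;> simp

end QAlg

/-- Boosted subroutines: OR searches for an argument `true`, NAND for an argument `false`, and AND
is the negation of NAND. -/
noncomputable def boostedGate : GateLabel → ℕ → (d : ℕ) → QAlg (BitOracle d) Bool
  | _, _, 0 => QAlg.miss
  | .nand, k, d + 1 => boostedSearch (d + 1) false k
  | .and, k, d + 1 => (boostedSearch (d + 1) false k).negate
  | .or, k, d + 1 => boostedSearch (d + 1) true k

theorem nand_eval_eq {d : ℕ} (x : Fin d → Bool) :
    GateLabel.nand.eval x = decide (∃ z, x z = false) := by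
  simp [GateLabel.eval, ← decide_not]

theorem isBoosted_boostedGate : IsBoosted boostedGate := by
  refine ⟨15, fun h k d hk hd => ?_⟩
  obtain ⟨d, rfl⟩ := Nat.exists_eq_succ_of_ne_zero (Nat.one_le_iff_ne_zero.1 hd)
  have hc : ENNReal.ofReal (1 / 2 ^ k) ≤ ENNReal.ofReal (15 / 2 ^ k) :=
    ENNReal.ofReal_le_ofReal (by gcongr; norm_num)
  cases h with
  | nand =>
    refine ⟨cost_boostedSearch_le false hk, fun x => ?_⟩
    rw [nand_eval_eq]
    exact (boostedSearch_error_le x false hk).trans hc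
  | and =>
    refine ⟨cost_boostedSearch_le false hk, fun x => ?_⟩
    have : GateLabel.and.eval x = !GateLabel.nand.eval x := by simp [GateLabel.eval]
    rw [this, nand_eval_eq]
    exact (QAlg.toOuterMeasure_dist_negate _ _ _).trans_le
      ((boostedSearch_error_le x false hk).trans hc)
  | or =>
    exact ⟨cost_boostedSearch_le true hk, fun x => (boostedSearch_error_le x true hk).trans hc⟩

/-! ### Lifted subroutines -/

theorem bit_literal (a σ : Bool) : bit (literal a σ) = bit a + 1 + bit σ := by
  cases a <;> cases σ <;> decide

section Lift

variable {n : ℕ} [NeZero n] {d : ℕ}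

theorem cost_liftAlg (i : Fin n) (Q : QAlg (BitOracle d) Bool) :
    (liftAlg i Q).cost = 4 * Q.cost := by
  have h : ∀ l : List (QStep (BitOracle d) Q.S),
      ((l.flatMap (liftStep i)).map QStep.cost).sum = 4 * (l.map QStep.cost).sum := by
    intro l
    induction l with
    | nil => rfl
    | cons q l ih =>
      rw [List.flatMap_cons, List.map_append, List.sum_append, ih, List.map_cons, List.sum_cons,
        mul_add]
      cases q <;> simp [liftStep, QStep.cost]
  exact h Q.steps

/-- The extra register returns to `0` after every lifted step, which acts on the main register as
the given step does for the string of the arguments of `i`. -/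
theorem foldl_act_liftStep (i : Fin n) {S : Type} [Fintype S] [DecidableEq S]
    (q : QStep (BitOracle d) S) (M : Box n) (y : Fin d → Bool)
    (hy : ∀ z : Fin d, y z = literal (M.val (M.nbr i z)) (M.label i z)) (ψ : S → ℂ) :
    (liftStep i q).foldl (fun ψ q => q.act M.contents ψ)
        (fun a : S × Fin n => if a.2 = 0 then ψ a.1 else 0) =
      fun a => if a.2 = 0 then q.act (bitContents y) ψ a.1 else 0 := by
  cases q with
  | gate U =>
    funext a
    rcases a with ⟨s, w⟩
    simp only [liftStep, List.foldl_cons, List.foldl_nil, QStep.act]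
    rw [liftGate_mulVec]
    split_ifs
    · rfl
    · exact congrFun (Matrix.mulVec_zero _) s
  | query p R e addr =>
    let e' : S ≃ R × ZMod 2 := e
    let addr' : R → Fin d := addr
    -- The state is tracked as a function of the three registers.
    let emb : (R → ZMod 2 → Fin n → ℂ) → S × Fin n → ℂ :=
      fun χ a => χ (e' a.1).1 (e' a.1).2 a.2
    let word : S × Fin n ≃ (R × ZMod 2) × Fin n := e'.prodCongr (Equiv.refl _)
    let bitReg : S × Fin n ≃ (R × Fin n) × ZMod 2 :=
      word.trans
        { toFun := fun p => ((p.1.1, p.2), p.1.2)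
          invFun := fun p => ((p.1.1, p.2), p.1.2)
          left_inv := fun _ => rfl
          right_inv := fun _ => rfl }
    have hnbr : ∀ χ, QStep.act M.contents
        (.query (O := BoxOracle n) BoxPort.nbr (R × ZMod 2) word
          (fun r => (i, (addr' r.1 : ℕ)))) (emb χ) =
        emb fun r b w => χ r b (w - M.nbr i (addr' r)) := by
      intro χ
      funext ⟨s, w⟩
      change emb χ (e'.symm (e' s), w - M.nbr i (addr' (e' s).1)) = _
      rw [Equiv.symm_apply_apply]
    have hlabel : ∀ χ, QStep.act M.contents
        (.query (O := BoxOracle n) BoxPort.label (R × Fin n) bitReg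
          (fun r => (i, (addr' r.1 : ℕ)))) (emb χ) =
        emb fun r b w => χ r (b - bit (M.label i (addr' r))) w := by
      intro χ
      funext ⟨s, w⟩
      change emb χ (e'.symm ((e' s).1, (e' s).2 - bit (M.label i (addr' (e' s).1))), w) = _
      simp only [emb, Equiv.apply_symm_apply]
    have hval : ∀ χ, QStep.act M.contents
        (.query (O := BoxOracle n) BoxPort.val (R × Fin n) bitReg (fun r => r.2)) (emb χ) =
        emb fun r b w => χ r (b - bit (M.val w)) w := by
      intro χ
      funext ⟨s, w⟩
      change emb χ (e'.symm ((e' s).1, (e' s).2 - bit (M.val w)), w) = _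
      simp only [emb, Equiv.apply_symm_apply]
    have hadd : ∀ χ, QStep.act M.contents
        (.gate (permGate ((bitReg.trans
          ((Equiv.refl (R × Fin n)).prodCongr (Equiv.addRight (1 : ZMod 2)))).trans bitReg.symm)))
          (emb χ) = emb fun r b w => χ r (b - 1) w := by
      intro χ
      funext ⟨s, w⟩
      refine (permGate_mulVec _ _ _).trans ?_
      change emb χ (e'.symm ((e' s).1, (e' s).2 + -1), w) = _
      simp only [emb, Equiv.apply_symm_apply, sub_eq_add_neg]
    have hneg : ∀ χ, QStep.act M.contents
        (.gate (permGate ((Equiv.refl S).prodCongr (Equiv.neg (Fin n))))) (emb χ) =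
        emb fun r b w => χ r b (-w) := by
      intro χ
      funext ⟨s, w⟩
      exact permGate_mulVec _ _ _
    have hin : (fun a : S × Fin n => if a.2 = 0 then ψ a.1 else 0) =
        emb fun r b w => if w = 0 then ψ (e'.symm (r, b)) else 0 := by
      funext a
      simp [emb]
    have hstep : liftStep (n := n) i (.query p R e addr) =
      [ .query (O := BoxOracle n) BoxPort.nbr (R × ZMod 2) word (fun r => (i, (addr' r.1 : ℕ))),
        .query (O := BoxOracle n) BoxPort.label (R × Fin n) bitReg
          (fun r => (i, (addr' r.1 : ℕ))),
        .gate (permGate ((bitReg.trans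
          ((Equiv.refl (R × Fin n)).prodCongr (Equiv.addRight (1 : ZMod 2)))).trans bitReg.symm)),
        .query (O := BoxOracle n) BoxPort.val (R × Fin n) bitReg (fun r => r.2),
        .gate (permGate ((Equiv.refl S).prodCongr (Equiv.neg (Fin n)))),
        .query (O := BoxOracle n) BoxPort.nbr (R × ZMod 2) word
          (fun r => (i, (addr' r.1 : ℕ))) ] := rfl
    rw [hstep, hin]
    simp only [List.foldl_cons, List.foldl_nil, hnbr, hlabel, hadd, hval, hneg]
    funext ⟨s, w⟩
    change (if -(w - M.nbr i (addr' (e' s).1)) - M.nbr i (addr' (e' s).1) = 0 then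
      ψ (e'.symm ((e' s).1, (e' s).2 - bit (M.val (-(w - M.nbr i (addr' (e' s).1)))) - 1 -
        bit (M.label i (addr' (e' s).1)))) else 0) =
      if w = 0 then ψ (e'.symm ((e' s).1, (e' s).2 - bit (y (addr' (e' s).1)))) else 0
    have hw : -(w - M.nbr i (addr' (e' s).1)) - M.nbr i (addr' (e' s).1) = -w := by abel
    by_cases hw0 : w = 0
    · subst hw0
      have hj : -(0 - M.nbr i (addr' (e' s).1)) = M.nbr i (addr' (e' s).1) := by abel
      rw [if_pos (by rw [hw, neg_zero]), if_pos rfl, hy, bit_literal, hj]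
      congr 3
      ring
    · rw [if_neg (by rwa [hw, neg_eq_zero]), if_neg hw0]

/-- On a memory whose arguments at `i` form the string `y`, the lifted algorithm has the same
output distribution as the given one on `y`. -/
theorem dist_liftAlg (i : Fin n) (Q : QAlg (BitOracle d) Bool) (M : Box n) (y : Fin d → Bool)
    (hy : ∀ z : Fin d, y z = literal (M.val (M.nbr i z)) (M.label i z)) :
    (liftAlg i Q).dist M.contents = Q.dist (bitContents y) := by
  classical
  have hf : ∀ (l : List (QStep (BitOracle d) Q.S)) (ψ : Q.S → ℂ),
      (l.flatMap (liftStep i)).foldl (fun ψ q => q.act M.contents ψ)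
        (fun a : Q.S × Fin n => if a.2 = 0 then ψ a.1 else 0) =
      fun a => if a.2 = 0 then l.foldl (fun ψ q => q.act (bitContents y) ψ) ψ a.1 else 0 := by
    intro l
    induction l with
    | nil => intro ψ; rfl
    | cons q l ih =>
      intro ψ
      rw [List.flatMap_cons, List.foldl_append, foldl_act_liftStep i q M y hy, ih,
        List.foldl_cons]
  have hinit : (Pi.single (Q.init, 0) 1 : Q.S × Fin n → ℂ) =
      fun a => if a.2 = 0 then (Pi.single Q.init 1 : Q.S → ℂ) a.1 else 0 := by
    funext ⟨s, w⟩
    simp only [Pi.single_apply, Prod.mk.injEq]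
    split_ifs <;> simp_all
  have hfinal : ∀ a : Q.S × Fin n, (liftAlg i Q).final M.contents a =
      if a.2 = 0 then Q.final (bitContents y) a.1 else 0 := by
    intro a
    refine Eq.trans ?_ (congrFun (hf Q.steps (Pi.single Q.init 1)) a)
    rw [← hinit]
    rfl
  apply PMF.toOuterMeasure_injective
  ext B
  rw [QAlg.toOuterMeasure_dist, QAlg.toOuterMeasure_dist]
  congr 1
  rw [Finset.sum_filter, Finset.sum_filter]
  calc _ = ∑ a : Q.S × Fin n, if Q.out a.1 ∈ B then
          ‖if a.2 = 0 then Q.final (bitContents y) a.1 else 0‖ ^ 2 else 0 :=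
        Finset.sum_congr rfl fun a _ =>
          congrArg (fun z : ℂ => if Q.out (Prod.fst a) ∈ B then ‖z‖ ^ 2 else 0) (hfinal a)
    _ = _ := by
        rw [Fintype.sum_prod_type]
        refine Finset.sum_congr rfl fun s _ => ?_
        rw [Finset.sum_eq_single 0]
        · simp
        · intro w _ hw
          simp [hw]
        · simp

end Lift

/-! ### Counting edges and sinks -/

namespace CircuitDag

variable {n : ℕ} {ι : Type} (G : CircuitDag n ι)

theorem deg_eq_zero_iff (i : Fin n) : G.deg i = 0 ↔ G.nhat ≤ i := by
  refine ⟨fun h => ?_, G.sinks_last i⟩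
  -- The vertices from `n̂` on are sinks, and there are as many of them as there are sinks.
  have hsub : (Finset.univ.filter fun j : Fin n => G.nhat ≤ (j : ℕ)) ⊆ G.sinks := fun j hj =>
    Finset.mem_filter.2 ⟨Finset.mem_univ _, G.sinks_last j (Finset.mem_filter.1 hj).2⟩
  have hn : G.sinks.card ≤ n := (Finset.card_le_univ _).trans_eq (Fintype.card_fin n)
  have hcard : (Finset.univ.filter fun j : Fin n => G.nhat ≤ (j : ℕ)).card = G.sinks.card := by
    have h1 : (Finset.univ.filter fun j : Fin n => (j : ℕ) < G.nhat).card = min n G.nhat :=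
      Fin.card_filter_val_lt
    have h2 := Finset.card_filter_add_card_filter_not (s := (Finset.univ : Finset (Fin n)))
      (fun j : Fin n => (j : ℕ) < G.nhat)
    simp only [not_lt, Finset.card_univ, Fintype.card_fin] at h2
    rw [h1] at h2
    unfold nhat at h2 ⊢
    omega
  have hmem : i ∈ G.sinks := Finset.mem_filter.2 ⟨Finset.mem_univ _, h⟩
  rw [← Finset.eq_of_subset_of_card_le hsub hcard.ge] at hmem
  exact (Finset.mem_filter.1 hmem).2

theorem m_eq_sum_deg : G.m = ∑ i, G.deg i := by
  have h : G.edges = (Finset.univ : Finset ((i : Fin n) × Fin (G.deg i))).image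
      fun a => (a.1, G.D a.1 a.2) := by
    ext ⟨i, j⟩
    simp [edges]
  rw [m, h, Finset.card_image_of_injective, Finset.card_univ, Fintype.card_sigma]
  · simp
  · rintro ⟨i, z⟩ ⟨i', z'⟩ h
    obtain ⟨rfl, h⟩ := Prod.mk.inj h
    exact congrArg (Sigma.mk i) (G.D_injective i h)

theorem two_mul_nhat_le_m : 2 * G.nhat ≤ G.m := by
  have hcard : (Finset.univ.filter fun j : Fin n => (j : ℕ) < G.nhat).card = G.nhat := by
    rw [Fin.card_filter_val_lt]
    exact min_eq_right (Nat.sub_le _ _)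
  rw [m_eq_sum_deg]
  calc 2 * G.nhat = ∑ i with (i : Fin n).val < G.nhat, 2 := by
        rw [Finset.sum_const, hcard, smul_eq_mul, mul_comm]
    _ ≤ ∑ i with (i : Fin n).val < G.nhat, G.deg i := by
        refine Finset.sum_le_sum fun i hi => ?_
        have h0 : G.deg i ≠ 0 := fun h =>
          absurd ((G.deg_eq_zero_iff i).1 h) (not_le.2 (Finset.mem_filter.1 hi).2)
        have := G.deg_ne_one i
        omega
    _ ≤ ∑ i, G.deg i := Finset.sum_le_sum_of_subset (Finset.filter_subset _ _)

end CircuitDag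

/-! ### Cost and error of the evaluation loop -/

section EvalLoop

variable {n : ℕ}

/-- Charging for an access does not change the error probability. -/
theorem toOuterMeasure_map_add {α : Type} (P : PMF (α × ℕ)) (c : ℕ) (v : α) :
    (P.map fun p => (p.1, p.2 + c)).toOuterMeasure {p | p.1 ≠ v} =
      P.toOuterMeasure {p | p.1 ≠ v} := by
  rw [PMF.toOuterMeasure_map_apply]
  rfl

/-- A memory holds the graph `G`, whatever bits are stored. -/
structure Box.Holds {ι : Type} (M : Box n) (G : CircuitDag n ι) : Prop where
  deg : M.deg = G.deg
  gate : M.gate = G.gate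
  nbr : ∀ i (z : Fin (G.deg i)), M.nbr i z = G.D i z
  label : ∀ i (z : Fin (G.deg i)), M.label i z = G.σ i (G.D i z)

variable {ι : Type} {G : CircuitDag n ι}

theorem Box.Holds.store {M : Box n} (h : M.Holds G) (i : Fin n) (b : Bool) :
    (M.store i b).Holds G := ⟨h.deg, h.gate, h.nbr, h.label⟩

theorem CircuitDag.holds_box (x : ι → Bool) : (G.box x).Holds G where
  deg := rfl
  gate := rfl
  nbr i z := by simp [CircuitDag.box]
  label i z := by simp [CircuitDag.box]

variable [NeZero n] (Q : GateLabel → ℕ → (d : ℕ) → QAlg (BitOracle d) Bool) (k : ℕ) (s : Fin n)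

/-- The running time of the loop does not depend on the outcomes of the measurements. -/
theorem cost_evalLoop (l : List (Fin n)) {M : Box n} (hM : M.Holds G) :
    ∀ p ∈ ((evalLoop Q k s l).run M).support,
      p.2 = (l.map fun i => 4 * (Q (G.gate i) k (G.deg i)).cost + 3).sum + 1 := by
  induction l generalizing M with
  | nil =>
    intro p hp
    simp only [evalLoop, Prog.run, PMF.support_map, PMF.support_pure, Set.image_singleton,
      Set.mem_singleton_iff] at hp
    simp [hp]
  | cons i l ih =>
    intro p hp
    simp only [evalLoop, Prog.run, PMF.support_map, PMF.support_bind, Set.mem_image,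
      Set.mem_iUnion, cost_liftAlg] at hp
    rw [congrFun hM.deg i, congrFun hM.gate i] at hp
    obtain ⟨_, ⟨_, ⟨b, hb, _, ⟨q, hq, rfl⟩, rfl⟩, rfl⟩, rfl⟩ := hp
    rw [List.map_cons, List.sum_cons]
    simp only [ih (hM.store i b) q hq]
    ring

/-- The error probability of the loop over a decreasing list of non-sinks, if the stored bits of
all other vertices from `s` on are correct. -/
theorem error_evalLoop (x : ι → Bool) {ε : ENNReal}
    (hQ : ∀ i, G.deg i ≠ 0 → ∀ y : Fin (G.deg i) → Bool,
      ((Q (G.gate i) k (G.deg i)).dist (bitContents y)).toOuterMeasure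
        {b | b ≠ (G.gate i).eval y} ≤ ε)
    (l : List (Fin n)) (hl : l.Pairwise (· > ·)) (hl0 : ∀ i ∈ l, s ≤ i ∧ G.deg i ≠ 0)
    {M : Box n} (hM : M.Holds G) (hval : ∀ j, s ≤ j → j ∉ l → M.val j = G.value x j) :
    ((evalLoop Q k s l).run M).toOuterMeasure {p | p.1 ≠ G.value x s} ≤ l.length * ε := by
  induction l generalizing M with
  | nil =>
    rw [evalLoop, Prog.run, toOuterMeasure_map_add, Prog.run, PMF.toOuterMeasure_pure_apply]
    simp [hval s le_rfl]
  | cons i l ih =>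
    obtain ⟨hil, hl⟩ := List.pairwise_cons.1 hl
    obtain ⟨hsi, hdeg⟩ := hl0 i List.mem_cons_self
    have hdist : (liftAlg i (Q (G.gate i) k (G.deg i))).dist M.contents =
        (Q (G.gate i) k (G.deg i)).dist
          (bitContents fun z => literal (G.value x (G.D i z)) (G.σ i (G.D i z))) := by
      refine dist_liftAlg _ _ _ _ fun z => ?_
      rw [hM.nbr, hM.label, hval]
      · exact hsi.trans (G.sorted i z).le
      · intro hmem
        rcases List.mem_cons.1 hmem with h | h
        · exact (G.sorted i z).ne' h
        · exact absurd (G.sorted i z) (not_lt.2 (hil _ h).le)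
    have hvalue : G.value x i =
        (G.gate i).eval fun z => literal (G.value x (G.D i z)) (G.σ i (G.D i z)) := by
      rw [CircuitDag.value, if_neg hdeg]
    have herr := hQ i hdeg fun z => literal (G.value x (G.D i z)) (G.σ i (G.D i z))
    rw [← hdist, ← hvalue] at herr
    rw [evalLoop, Prog.run, toOuterMeasure_map_add, Prog.run, toOuterMeasure_map_add, Prog.run,
      PMF.toOuterMeasure_bind_apply, tsum_fintype]
    simp only [toOuterMeasure_map_add, Prog.run]
    rw [congrFun hM.deg i, congrFun hM.gate i]
    set P := (liftAlg i (Q (G.gate i) k (G.deg i))).dist M.contents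
    have hgood : ((evalLoop Q k s l).run (M.store i (G.value x i))).toOuterMeasure
        {p | p.1 ≠ G.value x s} ≤ l.length * ε := by
      refine ih hl (fun j hj => hl0 j (List.mem_cons_of_mem _ hj)) (hM.store i _) ?_
      intro j hj hjl
      by_cases hji : j = i
      · subst hji
        exact Function.update_self ..
      · exact (Function.update_of_ne hji ..).trans
          (hval j hj (by simp [hji, hjl]))
    have hbad : P (!G.value x i) ≤ ε := by
      refine le_trans (le_of_eq ?_) herr
      rw [← PMF.toOuterMeasure_apply_singleton]
      congr 1
      ext b
      cases b <;> cases G.value x i <;> simp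
    have hle : ∀ (P : PMF (Bool × ℕ)) (B : Set (Bool × ℕ)), P.toOuterMeasure B ≤ 1 := by
      intro P B
      refine (P.toOuterMeasure.mono (Set.subset_univ B)).trans_eq ?_
      exact (PMF.toOuterMeasure_apply_eq_one_iff _ _).2 (Set.subset_univ _)
    have hsum : ∀ f : Bool → ENNReal, ∑ b, f b = f (G.value x i) + f (!G.value x i) := by
      intro f
      rw [Fintype.sum_bool]
      cases G.value x i
      · exact add_comm _ _
      · rfl
    -- Union bound: either this gate is wrong, or the error arises in the rest of the loop.
    rw [hsum, List.length_cons, Nat.cast_succ, add_mul, one_mul]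
    exact add_le_add ((mul_le_of_le_one_left' (P.coe_le_one _)).trans hgood)
      ((mul_le_of_le_one_right' (hle _ _)).trans hbad)

end EvalLoop

/-! ### The order of evaluation and the boosting parameter -/

/-- The non-sinks from the root on, in the order of their evaluation. -/
def evalOrder {n : ℕ} (nhat : ℕ) (s : Fin n) : List (Fin n) :=
  (List.finRange n).reverse.filter fun i => decide (s ≤ i ∧ (i : ℕ) < nhat)

section

variable {n : ℕ} {nhat : ℕ} {s : Fin n}

theorem mem_evalOrder {i : Fin n} : i ∈ evalOrder nhat s ↔ s ≤ i ∧ (i : ℕ) < nhat := by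
  simp [evalOrder]

theorem pairwise_evalOrder : (evalOrder nhat s).Pairwise (· > ·) :=
  (List.pairwise_reverse.2 (List.pairwise_lt_finRange n)).filter _

theorem sum_evalOrder_le (f : Fin n → ℝ) (hf : ∀ i, 0 ≤ f i) :
    ((evalOrder nhat s).map f).sum ≤ ∑ i with (i : Fin n).val < nhat, f i := by
  have hnd : (evalOrder nhat s).Nodup := pairwise_evalOrder.imp fun h => h.ne'
  rw [← List.sum_toFinset f hnd]
  refine Finset.sum_le_sum_of_subset_of_nonneg (fun i hi => ?_) fun i _ _ => hf i
  exact Finset.mem_filter.2 ⟨Finset.mem_univ _, (mem_evalOrder.1 (List.mem_toFinset.1 hi)).2⟩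

theorem length_evalOrder_le : (evalOrder nhat s).length ≤ nhat := by
  have hnd : (evalOrder nhat s).Nodup := pairwise_evalOrder.imp fun h => h.ne'
  rw [← List.toFinset_card_of_nodup hnd, ← Finset.card_map Fin.valEmbedding]
  refine (Finset.card_le_card (t := Finset.range nhat) fun a ha => ?_).trans_eq
    (Finset.card_range _)
  obtain ⟨i, hi, rfl⟩ := Finset.mem_map.1 ha
  exact Finset.mem_range.2 (mem_evalOrder.1 (List.mem_toFinset.1 hi)).2

end

/-- The Cauchy–Schwarz inequality for the out-degrees of the non-sinks. -/
theorem CircuitDag.sum_sqrt_deg_le {n : ℕ} {ι : Type} (G : CircuitDag n ι) :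
    ∑ i with (i : Fin n).val < G.nhat, √(G.deg i : ℝ) ≤ √((G.nhat : ℝ) * G.m) := by
  refine Real.le_sqrt_of_sq_le ?_
  refine (sq_sum_le_card_mul_sum_sq (s := Finset.univ.filter fun i : Fin n => i.val < G.nhat)
    (f := fun i => √(G.deg i : ℝ))).trans ?_
  have hcard : (Finset.univ.filter fun j : Fin n => (j : ℕ) < G.nhat).card = G.nhat := by
    rw [Fin.card_filter_val_lt]
    exact min_eq_right (Nat.sub_le _ _)
  rw [hcard, G.m_eq_sum_deg]
  push_cast
  gcongr
  simp only [Real.sq_sqrt (Nat.cast_nonneg _)]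
  exact Finset.sum_le_sum_of_subset_of_nonneg (Finset.filter_subset _ _)
    fun i _ _ => Nat.cast_nonneg _

/-- The boosting parameter for `N` non-sinks. -/
noncomputable def boostParam (N : ℕ) : ℕ := ⌈2 * Real.logb 2 N⌉₊

theorem one_le_boostParam {N : ℕ} (hN : 2 ≤ N) : 1 ≤ boostParam N :=
  Nat.one_le_ceil_iff.2 (mul_pos two_pos (Real.logb_pos one_lt_two (by exact_mod_cast hN)))

theorem boostParam_le {N : ℕ} (hN : 2 ≤ N) : (boostParam N : ℝ) ≤ 6 * Real.log N := by
  have hN' : (2 : ℝ) ≤ N := by exact_mod_cast hN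
  have hlog2 : Real.log 2 ≤ Real.log N := Real.log_le_log two_pos hN'
  have h2 := Real.log_two_gt_d9
  have h1 : (boostParam N : ℝ) < 2 * Real.logb 2 N + 1 :=
    Nat.ceil_lt_add_one (mul_nonneg zero_le_two (Real.logb_nonneg one_lt_two (by linarith)))
  have h3 : Real.logb 2 N ≤ 3 / 2 * Real.log N := by
    rw [Real.logb, div_le_iff₀ (by linarith)]
    nlinarith
  linarith

theorem sq_le_two_pow_boostParam {N : ℕ} (hN : 2 ≤ N) : (N : ℝ) ^ 2 ≤ 2 ^ boostParam N := by
  have hN' : (0 : ℝ) < N := by positivity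
  calc (N : ℝ) ^ 2 = ((2 : ℝ) ^ Real.logb 2 N) ^ 2 := by
        rw [Real.rpow_logb two_pos (by norm_num) hN']
    _ = (2 : ℝ) ^ (2 * Real.logb 2 N) := by
        rw [← Real.rpow_natCast, ← Real.rpow_mul zero_le_two]
        push_cast
        ring_nf
    _ ≤ (2 : ℝ) ^ ((boostParam N : ℕ) : ℝ) :=
        Real.rpow_le_rpow_of_exponent_le one_le_two (Nat.le_ceil _)
    _ = 2 ^ boostParam N := Real.rpow_natCast _ _

/-! ### Running time and error probability of the evaluation algorithm -/

/-- With boosted subroutines the algorithm is fast and reliable, with a constant that depends only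
on that of the subroutines: a lifted query costs four, `√k` is at most `3 √(log n̂)`, and the
classical accesses, at most `3 n̂ + 1`, are absorbed by `4 n̂`. -/
theorem evaluatesWithin_of_bounds (Q : GateLabel → ℕ → (d : ℕ) → QAlg (BitOracle d) Bool) {c : ℝ}
    (hc : 0 ≤ c)
    (hQ : ∀ (h : GateLabel) (k d : ℕ), 1 ≤ k → 1 ≤ d →
      ((Q h k d).cost : ℝ) ≤ c * √((k : ℝ) * d) ∧
      ∀ x : Fin d → Bool, ((Q h k d).dist (bitContents x)).toOuterMeasure {b | b ≠ h.eval x} ≤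
        ENNReal.ofReal (c / 2 ^ k))
    {n : ℕ} [NeZero n] {ι : Type} (G : CircuitDag n ι) (hG : 2 ≤ G.nhat) :
    EvaluatesWithin Q (12 * c + 4) G := by
  intro x s
  have hk := one_le_boostParam hG
  have hdeg : ∀ i : Fin n, (i : ℕ) < G.nhat → G.deg i ≠ 0 := fun i hi h =>
    absurd ((G.deg_eq_zero_iff i).1 h) (not_le.2 hi)
  have hN : (2 : ℝ) ≤ G.nhat := by exact_mod_cast hG
  have hNn : G.nhat ≤ n := Nat.sub_le _ _
  have hNn' : (G.nhat : ℝ) ≤ n := by exact_mod_cast hNn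
  have hm : 2 * (G.nhat : ℝ) ≤ G.m := by exact_mod_cast G.two_mul_nhat_le_m
  have hlog : 0.69 ≤ Real.log G.nhat :=
    le_trans (by linarith [Real.log_two_gt_d9]) (Real.log_le_log two_pos hN)
  have heval : evalAlg Q G.nhat s =
      evalLoop Q (boostParam G.nhat) s (evalOrder G.nhat s) := rfl
  refine ⟨fun p hp => ?_, ?_⟩
  · have hp2 : (p.2 : ℝ) ≤ (12 * c + 4) * √((G.nhat : ℝ) * G.m * Real.log G.nhat) := by
      rw [heval] at hp
      rw [cost_evalLoop Q _ s _ (G.holds_box x) p hp]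
      set k := boostParam G.nhat with hkdef
      have hbase : (G.nhat : ℝ) ≤ √((G.nhat : ℝ) * G.m * Real.log G.nhat) := by
        refine Real.le_sqrt_of_sq_le ?_
        have : (G.nhat : ℝ) * (2 * G.nhat * 0.69) ≤ G.nhat * (G.m * Real.log G.nhat) := by gcongr
        nlinarith
      have hroot : √(k : ℝ) * √((G.nhat : ℝ) * G.m) ≤
          3 * √((G.nhat : ℝ) * G.m * Real.log G.nhat) := by
        rw [← Real.sqrt_mul (by positivity)]
        refine Real.sqrt_le_iff.2 ⟨by positivity, ?_⟩
        rw [mul_pow, Real.sq_sqrt (by positivity)]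
        have := mul_le_mul_of_nonneg_left (boostParam_le hG)
          (by positivity : (0 : ℝ) ≤ G.nhat * G.m)
        have h0 : 0 ≤ (G.nhat : ℝ) * G.m * Real.log G.nhat := by positivity
        nlinarith
      calc (((((evalOrder G.nhat s).map fun i => 4 * (Q (G.gate i) k (G.deg i)).cost + 3).sum + 1
            : ℕ)) : ℝ)
          = ((evalOrder G.nhat s).map fun i =>
              4 * ((Q (G.gate i) k (G.deg i)).cost : ℝ) + 3).sum + 1 := by
            push_cast
            rw [List.map_map]
            congr 2
            refine List.map_congr_left fun i _ => ?_
            simp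
        _ ≤ ∑ i with (i : Fin n).val < G.nhat,
              (4 * ((Q (G.gate i) k (G.deg i)).cost : ℝ) + 3) + 1 := by
            gcongr
            exact sum_evalOrder_le _ fun i => by positivity
        _ ≤ ∑ i with (i : Fin n).val < G.nhat, (4 * c * √(k : ℝ) * √(G.deg i : ℝ) + 3) + 1 := by
            refine add_le_add_left (Finset.sum_le_sum fun i hi => ?_) 1
            have hi' := hdeg i (Finset.mem_filter.1 hi).2
            have := (hQ (G.gate i) k (G.deg i) hk (Nat.one_le_iff_ne_zero.2 hi')).1
            rw [Real.sqrt_mul (by positivity)] at this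
            linarith
        _ = 4 * c * √(k : ℝ) * (∑ i with (i : Fin n).val < G.nhat, √(G.deg i : ℝ)) +
              3 * G.nhat + 1 := by
            rw [Finset.sum_add_distrib, ← Finset.mul_sum, Finset.sum_const,
              Fin.card_filter_val_lt, min_eq_right hNn, nsmul_eq_mul]
            ring
        _ ≤ 4 * c * √(k : ℝ) * √((G.nhat : ℝ) * G.m) + 3 * G.nhat + 1 := by
            gcongr
            exact G.sum_sqrt_deg_le
        _ ≤ 4 * c * (3 * √((G.nhat : ℝ) * G.m * Real.log G.nhat)) +
              4 * √((G.nhat : ℝ) * G.m * Real.log G.nhat) := by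
            have := mul_le_mul_of_nonneg_left hroot (by positivity : 0 ≤ 4 * c)
            linarith
        _ = _ := by ring
    refine ⟨hp2, hp2.trans ?_⟩
    gcongr
  · have h := error_evalLoop Q (boostParam G.nhat) s x
      (ε := ENNReal.ofReal (c / 2 ^ boostParam G.nhat))
      (fun i hi y => (hQ _ _ _ hk (Nat.one_le_iff_ne_zero.2 hi)).2 y)
      (evalOrder G.nhat s) pairwise_evalOrder
      (fun i hi => ⟨(mem_evalOrder.1 hi).1, hdeg i (mem_evalOrder.1 hi).2⟩) (G.holds_box x)
      (fun j hj hjl => by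
        have hjs : G.deg j = 0 := (G.deg_eq_zero_iff j).2
          (le_of_not_gt fun hlt => hjl (mem_evalOrder.2 ⟨hj, hlt⟩))
        rw [CircuitDag.value, if_pos hjs]
        exact if_pos hjs)
    rw [heval]
    refine h.trans ?_
    rw [← ENNReal.ofReal_natCast, ← ENNReal.ofReal_mul (Nat.cast_nonneg _)]
    refine ENNReal.ofReal_le_ofReal ?_
    have hlen : ((evalOrder G.nhat s).length : ℝ) ≤ G.nhat := by exact_mod_cast length_evalOrder_le
    calc ((evalOrder G.nhat s).length : ℝ) * (c / 2 ^ boostParam G.nhat)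
        ≤ G.nhat * (c / (G.nhat : ℝ) ^ 2) := by
          gcongr
          exact sq_le_two_pow_boostParam hG
      _ = c / G.nhat := by field_simp
      _ ≤ _ := by
          gcongr
          linarith

theorem theorem2 :
    (∃ Q : GateLabel → ℕ → (d : ℕ) → QAlg (BitOracle d) Bool, IsBoosted Q) ∧
    ∀ Q : GateLabel → ℕ → (d : ℕ) → QAlg (BitOracle d) Bool, IsBoosted Q →
      ∃ C : ℝ,
        (∀ (n : ℕ) [NeZero n] (ι : Type) (G : CircuitDag n ι), 2 ≤ G.nhat →
          EvaluatesWithin Q C G) ∧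
        (∀ (n : ℕ) [NeZero n] (ι : Type) (G : CircuitDag n ι), G.IsNandNot → 2 ≤ G.nhat →
          EvaluatesWithin Q C G) := by
  refine ⟨⟨boostedGate, isBoosted_boostedGate⟩, ?_⟩
  rintro Q ⟨c, hQ⟩
  have hc : 0 ≤ c := by
    have h := (Nat.cast_nonneg _).trans (hQ GateLabel.nand 1 1 le_rfl le_rfl).1
    simpa using h
  have hmain : ∀ (n : ℕ) [NeZero n] (ι : Type) (G : CircuitDag n ι), 2 ≤ G.nhat →
      EvaluatesWithin Q (12 * c + 4) G :=
    fun n _ ι G hG => evaluatesWithin_of_bounds Q hc hQ G hG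
  exact ⟨12 * c + 4, hmain, fun n _ ι G _ hG => hmain n ι G hG⟩
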